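/- Let $p$, $q$ and $r$ be distinct primes and let $G$ be a group of order $|G| = pqr$. Then every connected Cayley graph on $G$ has a hamiltonian cycle. That is, for every subset $S \subseteq G$, let $\mathrm{Cay}(G;S)$ be the graph whose vertices are the elements of $G$, with an edge joining $g$ and $gs$ for every $g \in G$ and $s \in S$ (loops, which arise only if $S$ contains the identity, are disregarded). If $\mathrm{Cay}(G;S)$ is connected, then it contains a cycle that visits every vertex exactly once. -/

import Mathlib

/-! A hamiltonian cycle is encoded as a word in the generators and their inverses: product `1`,
length `|G|`, every element a partial product (`IsTour`). Since `|G|` is squarefree, `G` is a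
Z-group, so its commutator subgroup is cyclic of some order `n` and has a complement. Elements then
have affine coordinates `(α g, ν g)` in the abelianization `Q` and in `ZMod n`, with `ν (g * h) = ν
g + χ g * ν h`, where `χ` describes conjugation. Some `χ a - 1` is a unit, as otherwise `ν` would
survive on an abelian quotient.

The engine is the factor group lemma (`IsTour.of_powers`). A word that projects to a tour of `Q` and
whose product generates the kernel of `α` gives a tour of `G` when repeated `n` times, so the task
is to find such a word with `ν` of its product a unit. Tours of abelian groups come from snake-like
walks through the cosets of a subgroup (`hasTour_top`). Changing the origin (`gauge`) makes a chosen
generator `s` with `χ s - 1` a unit satisfy `ν s = 0`, and then `ν` of the product is an explicit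
expression. Where the basic word can fail, powers of a generator `t` are inserted between its
letters (`interleave`), or the word is made to multiply to a central element.

The value of `n` divides `pqr`. If `n = 1`, the group is abelian. If `n` is a product of two primes,
`Q` has prime order, and a unit is assembled from generators nonzero modulo each prime
(`exists_tour_of_prime_card`). If `n` is prime, two noncommuting generators exist, and their orders
modulo the kernel decide which word to use (`exists_tour_of_prime_kernel`). The value `n = pqr` is
excluded because `χ` would be trivial. -/

/-- The vertices visited by the walk that starts at `g` and reads the word `L`, in order, without
its final vertex. -/
def visits {G : Type*} [Group G] : G → List G → List G
  | _, [] => []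
  | g, x :: L => g :: visits (g * x) L

/-! ### Words and the vertices they visit -/

section Visits

variable {G Q : Type*} [Group G] [Group Q]

@[simp] lemma length_visits (g : G) (L : List G) : (visits g L).length = L.length := by
  induction L generalizing g with
  | nil => rfl
  | cons x L ih => simp [visits, ih]

lemma visits_append (g : G) (A B : List G) :
    visits g (A ++ B) = visits g A ++ visits (g * A.prod) B := by
  induction A generalizing g with
  | nil => simp [visits]
  | cons x A ih => simp [visits, ih, mul_assoc]

/-- The condition `B ≠ []` appears because the end point of the walk is not listed. -/
lemma mem_visits_iff {g v : G} {L : List G} :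
    v ∈ visits g L ↔ ∃ A B, L = A ++ B ∧ B ≠ [] ∧ v = g * A.prod := by
  constructor
  · induction L generalizing g with
    | nil => simp [visits]
    | cons x L ih =>
      simp only [visits, List.mem_cons]
      rintro (rfl | h)
      · exact ⟨[], x :: L, by simp⟩
      · obtain ⟨A, B, rfl, hB, rfl⟩ := ih h
        exact ⟨x :: A, B, by simp [hB, mul_assoc]⟩
  · rintro ⟨A, B, rfl, hB, rfl⟩
    obtain ⟨y, B, rfl⟩ := List.exists_cons_of_ne_nil hB
    simp [visits_append, visits]

lemma visits_map (f : G →* Q) (g : G) (L : List G) :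
    visits (f g) (L.map f) = (visits g L).map f := by
  induction L generalizing g with
  | nil => rfl
  | cons x L ih => simp [visits, ← ih]

lemma visits_mul (h g : G) (L : List G) : visits (h * g) L = (visits g L).map (h * ·) := by
  induction L generalizing g with
  | nil => rfl
  | cons x L ih => simp [visits, ← ih, mul_assoc]

lemma mem_visits_mul {h g v : G} {L : List G} (hv : v ∈ visits g L) :
    h * v ∈ visits (h * g) L := by
  rw [visits_mul]; exact List.mem_map_of_mem hv

lemma mem_visits_append_left {g v : G} {A : List G} (B : List G) (h : v ∈ visits g A) :
    v ∈ visits g (A ++ B) := by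
  rw [visits_append]; exact List.mem_append_left _ h

lemma mem_visits_append_right {g v : G} {A B : List G} (h : v ∈ visits (g * A.prod) B) :
    v ∈ visits g (A ++ B) := by
  rw [visits_append]; exact List.mem_append_right _ h

lemma mem_visits_replicate (g x : G) {i k : ℕ} (h : i < k) :
    g * x ^ i ∈ visits g (List.replicate k x) := by
  rw [mem_visits_iff]
  refine ⟨List.replicate i x, List.replicate (k - i) x, ?_, ?_, by simp⟩
  · rw [← List.replicate_add]; congr 1; omega
  · simp; omega

lemma mem_visits_flatten_replicate {g v : G} {L : List G} {j k : ℕ} (hj : j < k)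
    (h : v ∈ visits (g * L.prod ^ j) L) : v ∈ visits g (List.replicate k L).flatten := by
  have : List.replicate k L = List.replicate j L ++ L :: List.replicate (k - j - 1) L := by
    rw [← List.replicate_succ, ← List.replicate_add]; congr 1; omega
  rw [this, List.flatten_append, List.flatten_cons]
  refine mem_visits_append_right (mem_visits_append_left _ ?_)
  simpa [List.prod_flatten] using h

end Visits

/-! ### Tours of subgroups and their extension across cosets -/

/-- The word `L`, read from `1`, is a closed walk through every element of `H` that is as long as
the order of `H`. -/
structure IsTour {G : Type*} [Group G] (H : Subgroup G) (L : List G) : Prop where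
  prod_eq : L.prod = 1
  length_eq : L.length = Nat.card H
  mem_visits : ∀ h ∈ H, h ∈ visits 1 L

section Tour

variable {G Q : Type*} [Group G] [Group Q]

/-- The factor group lemma, in a form that does not require normality. -/
lemma IsTour.of_powers [Finite G] {H : Subgroup G} {L : List G}
    (hlen : L.length * orderOf L.prod = Nat.card H)
    (hcov : ∀ h ∈ H, ∃ i : ℕ, ∃ v ∈ visits 1 L, h = L.prod ^ i * v) :
    IsTour H (List.replicate (orderOf L.prod) L).flatten where
  prod_eq := by simp [List.prod_flatten, pow_orderOf_eq_one]
  length_eq := by simp [List.length_flatten, ← hlen, mul_comm]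
  mem_visits h hh := by
    obtain ⟨i, v, hv, rfl⟩ := hcov h hh
    -- Only the residue of `i` matters, and it numbers the copy of `L` that visits the element.
    refine mem_visits_flatten_replicate (j := i % orderOf L.prod)
      (Nat.mod_lt _ (orderOf_pos _)) ?_
    rw [one_mul, pow_mod_orderOf]
    simpa using mem_visits_mul (h := L.prod ^ i) hv

/-- The word running forwards and backwards along `M` in consecutive cosets. -/
def zigzag (M : List G) (u : G) : List G :=
  M ++ u :: ((M.map (·⁻¹)).reverse ++ [u])

/-- The word that extends the closed walk `x :: M ++ [y]` to `2 * h + 1` cosets. -/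
def extendOdd (x : G) (M : List G) (y u : G) (h : ℕ) : List G :=
  x :: ((List.replicate h (zigzag M u)).flatten ++ (M ++ y :: List.replicate (2 * h) u⁻¹))

/-- The word that extends the closed walk `x :: M ++ [y]` to `2 * h + 2` cosets. -/
def extendEven (x : G) (M : List G) (u : G) (h : ℕ) : List G :=
  x :: ((List.replicate h (zigzag M u)).flatten ++
    (M ++ u :: ((M.map (·⁻¹)).reverse ++ x⁻¹ :: List.replicate (2 * h + 1) u⁻¹)))

lemma prod_zigzag {M : List G} {u : G} (hu : Commute u M.prod) : (zigzag M u).prod = u ^ 2 := by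
  have : M.prod * u = u * M.prod := hu.eq.symm
  simp [zigzag, ← List.prod_inv_reverse, pow_two, ← mul_assoc, this]

/-- Even cosets are crossed forwards and odd ones backwards. In an odd coset the vertex with prefix
`A` is reached after `M`, `u` and the inverse of `B`, and commutation with `u` identifies it. -/
lemma mem_visits_zigzags {x u : G} {M A B : List G} {h i : ℕ} (hM : M = A ++ B)
    (hx : Commute u x) (hA : Commute u A.prod) (hB : Commute u B.prod) (hi : i < 2 * h) :
    u ^ i * (x * A.prod) ∈ visits x (List.replicate h (zigzag M u)).flatten := by
  have hMu : Commute u M.prod := by rw [hM, List.prod_append]; exact hA.mul_right hB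
  refine mem_visits_flatten_replicate (j := i / 2) (by omega) ?_
  rw [prod_zigzag hMu, mem_visits_iff, ← pow_mul]
  rcases Nat.even_or_odd' i with ⟨j, rfl | rfl⟩
  · refine ⟨A, B ++ u :: ((M.map (·⁻¹)).reverse ++ [u]), by simp [zigzag, hM], by simp, ?_⟩
    rw [Nat.mul_div_cancel_left _ (by norm_num), ← mul_assoc, (hx.pow_left _).eq]
  · refine ⟨M ++ u :: (B.map (·⁻¹)).reverse, (A.map (·⁻¹)).reverse ++ [u],
      by simp [zigzag, hM], by simp, ?_⟩
    rw [show (2 * j + 1) / 2 = j by omega, ← mul_assoc, (hx.pow_left _).eq, hM]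
    have h1 : B.prod * u * B.prod⁻¹ = u := by rw [← hB.eq]; simp
    simp only [List.prod_append, List.prod_cons, ← List.prod_inv_reverse]
    calc x * u ^ (2 * j + 1) * A.prod = x * (u ^ (2 * j) * (u * A.prod)) := by
          rw [pow_succ]; simp [mul_assoc]
      _ = x * u ^ (2 * j) * (A.prod * (B.prod * u * B.prod⁻¹)) := by
          rw [hA.eq, h1]; simp [mul_assoc]
      _ = _ := by simp [mul_assoc]

lemma commute_list_prod {u : G} {L : List G} (h : ∀ z ∈ L, Commute u z) : Commute u L.prod := by
  induction L with
  | nil => simp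
  | cons x L ih =>
    rw [List.prod_cons]
    exact (h x (by simp)).mul_right (ih fun z hz => h z (by simp [hz]))

/-- Singles out the column of `1`, which the extended tours keep free for the way back. -/
lemma IsTour.eq_one_or_prefix {H : Subgroup G} {x y : G} {M : List G}
    (hL : IsTour H (x :: (M ++ [y]))) {g : G} (hg : g ∈ H) :
    g = 1 ∨ ∃ A B, M = A ++ B ∧ g = x * A.prod := by
  have := hL.mem_visits g hg
  simp only [visits, List.mem_cons, one_mul] at this
  refine this.imp id fun h => ?_
  obtain ⟨A, B, hAB, hB, rfl⟩ := mem_visits_iff.1 h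
  obtain ⟨B, z, rfl⟩ := (List.eq_nil_or_concat B).resolve_left hB
  rw [List.concat_eq_append, ← List.append_assoc] at hAB
  exact ⟨A, B, (List.append_inj' hAB rfl).1, rfl⟩

/-- As `u` commutes with all letters, each coset `u ^ i * H` is a translated copy of the closed
walk. The zigzags use the first `2 * h` cosets without the column of `1`; the last coset is crossed
forwards, `y` steps into that column, and the powers of `u⁻¹` descend it. -/
lemma IsTour.extendOdd {H K : Subgroup G} {x y u : G} {M : List G} {h : ℕ}
    (hL : IsTour H (x :: (M ++ [y]))) (hu : ∀ z ∈ x :: (M ++ [y]), Commute u z)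
    (hcard : Nat.card K = (2 * h + 1) * Nat.card H)
    (hcov : ∀ g ∈ K, ∃ i < 2 * h + 1, ∃ g' ∈ H, g = u ^ i * g') :
    IsTour K (extendOdd x M y u h) := by
  have hx : Commute u x := hu x (by simp)
  have hM : Commute u M.prod := commute_list_prod fun z hz => hu z (by simp [hz])
  have hy : Commute u y := hu y (by simp)
  have h1 : x * (M.prod * y) = 1 := by simpa using hL.prod_eq
  have hZ : (List.replicate h (zigzag M u)).flatten.prod = u ^ (2 * h) := by
    simp [List.prod_flatten, prod_zigzag hM, pow_mul]
  have h2 : x * u ^ (2 * h) * M.prod * y = u ^ (2 * h) := by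
    rw [← (hx.pow_left _).eq]; simp [mul_assoc, h1]
  refine ⟨?_, ?_, fun g hg => ?_⟩
  · simp only [_root_.extendOdd, List.prod_cons, List.prod_append, hZ, List.prod_replicate]
    simp only [← mul_assoc, h2]; simp
  · have := hL.length_eq
    simp only [List.length_cons, List.length_append, List.length_nil] at this
    rw [hcard, ← this]
    simp [_root_.extendOdd, zigzag, List.length_flatten]; ring
  · obtain ⟨i, hi, g', hg', rfl⟩ := hcov g hg
    simp only [_root_.extendOdd, visits, List.mem_cons, one_mul]
    rcases hL.eq_one_or_prefix hg' with rfl | ⟨A, B, hAB, rfl⟩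
    · rcases Nat.eq_zero_or_pos i with rfl | hi0
      · simp
      · right
        rw [mul_one]
        refine mem_visits_append_right (mem_visits_append_right ?_)
        rw [hZ, visits]
        refine List.mem_cons_of_mem _ ?_
        rw [h2]
        have := mem_visits_replicate (u ^ (2 * h)) u⁻¹ (show 2 * h - i < 2 * h by omega)
        rwa [inv_pow, ← pow_sub _ (by omega), show 2 * h - (2 * h - i) = i by omega] at this
    · right
      have hA : Commute u A.prod :=
        commute_list_prod fun z hz => hu z (by simp [hAB, hz])
      have hB : Commute u B.prod :=
        commute_list_prod fun z hz => hu z (by simp [hAB, hz])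
      rcases Nat.lt_or_ge i (2 * h) with hi' | hi'
      · exact mem_visits_append_left _ (mem_visits_zigzags hAB hx hA hB hi')
      · obtain rfl : i = 2 * h := by omega
        refine mem_visits_append_right ?_
        rw [hZ, mem_visits_iff]
        refine ⟨A, B ++ y :: List.replicate (2 * h) u⁻¹, by simp [hAB], by simp, ?_⟩
        rw [← mul_assoc, (hx.pow_left _).eq]

/-- With an even number of cosets the last one is crossed backwards, ending above `x`, so `x⁻¹`
instead of `y` leads into the column of `1`. -/
lemma IsTour.extendEven {H K : Subgroup G} {x y u : G} {M : List G} {h : ℕ}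
    (hL : IsTour H (x :: (M ++ [y]))) (hu : ∀ z ∈ x :: (M ++ [y]), Commute u z)
    (hcard : Nat.card K = (2 * h + 2) * Nat.card H)
    (hcov : ∀ g ∈ K, ∃ i < 2 * h + 2, ∃ g' ∈ H, g = u ^ i * g') :
    IsTour K (extendEven x M u h) := by
  have hx : Commute u x := hu x (by simp)
  have hM : Commute u M.prod := commute_list_prod fun z hz => hu z (by simp [hz])
  have hZ : (List.replicate h (zigzag M u)).flatten.prod = u ^ (2 * h) := by
    simp [List.prod_flatten, prod_zigzag hM, pow_mul]
  have h2 : x * u ^ (2 * h) * M.prod * u * M.prod⁻¹ * x⁻¹ = u ^ (2 * h + 1) := by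
    rw [← (hx.pow_left _).eq, mul_assoc _ M.prod u, ← hM.eq, mul_assoc, mul_assoc, mul_assoc,
      mul_assoc u, mul_inv_cancel_left, ← mul_assoc x, ← hx.eq, mul_assoc u, mul_inv_cancel,
      mul_one, pow_succ]
  refine ⟨?_, ?_, fun g hg => ?_⟩
  · simp only [_root_.extendEven, List.prod_cons, List.prod_append, hZ, List.prod_replicate,
      ← List.prod_inv_reverse]
    simp only [← mul_assoc, h2]; simp
  · have := hL.length_eq
    simp only [List.length_cons, List.length_append, List.length_nil] at this
    rw [hcard, ← this]
    simp [_root_.extendEven, zigzag, List.length_flatten]; ring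
  · obtain ⟨i, hi, g', hg', rfl⟩ := hcov g hg
    simp only [_root_.extendEven, visits, List.mem_cons, one_mul]
    rcases hL.eq_one_or_prefix hg' with rfl | ⟨A, B, hAB, rfl⟩
    · rcases Nat.eq_zero_or_pos i with rfl | hi0
      · simp
      · right
        rw [mul_one]
        refine mem_visits_append_right (mem_visits_append_right ?_)
        rw [hZ, visits]
        refine List.mem_cons_of_mem _ (mem_visits_append_right ?_)
        rw [visits]
        refine List.mem_cons_of_mem _ ?_
        rw [← List.prod_inv_reverse, h2]
        have := mem_visits_replicate (u ^ (2 * h + 1)) u⁻¹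
          (show 2 * h + 1 - i < 2 * h + 1 by omega)
        rwa [inv_pow, ← pow_sub _ (by omega), show 2 * h + 1 - (2 * h + 1 - i) = i by omega]
          at this
    · right
      have hA : Commute u A.prod :=
        commute_list_prod fun z hz => hu z (by simp [hAB, hz])
      have hB : Commute u B.prod :=
        commute_list_prod fun z hz => hu z (by simp [hAB, hz])
      -- The last two cosets are crossed by one more zigzag without its final `u`, so the count for
      -- `h + 1` zigzags applies after stripping that letter.
      have := mem_visits_zigzags (h := h + 1) hAB hx hA hB (show i < 2 * (h + 1) by omega)
      rw [List.replicate_succ', List.flatten_append, List.flatten_singleton] at this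
      rw [visits_append, List.mem_append] at this ⊢
      refine this.imp id fun hv => ?_
      rw [mem_visits_iff] at hv ⊢
      obtain ⟨C, D, hCD, hD, hv⟩ := hv
      obtain ⟨D, z, rfl⟩ := (List.eq_nil_or_concat D).resolve_left hD
      have hCD' : M ++ u :: (M.map (·⁻¹)).reverse = C ++ D := by
        refine (List.append_inj' (t₁ := [u]) (t₂ := [z]) ?_ rfl).1
        simpa [zigzag] using hCD
      refine ⟨C, D ++ x⁻¹ :: List.replicate (2 * h + 1) u⁻¹, ?_, by simp, hv⟩
      rw [← List.append_assoc, ← hCD']; simp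

end Tour

lemma exists_pow_of_mem_zpowers {G : Type*} [Group G] {x g : G} (hx : 0 < orderOf x)
    (hg : g ∈ Subgroup.zpowers x) : ∃ i < orderOf x, g = x ^ i := by
  classical
  obtain ⟨i, hi, rfl⟩ := Finset.mem_image.1
    ((orderOf_pos_iff.1 hx).mem_zpowers_iff_mem_range_orderOf.1 hg)
  exact ⟨i, Finset.mem_range.1 hi, rfl⟩

/-! ### Tours of abelian groups, one generator at a time -/

section Cosets

variable {G Q : Type*} [Group G] [Group Q]

lemma card_comap_of_surjective [Finite G] (f : G →* Q) (hf : Function.Surjective f)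
    (K : Subgroup Q) : Nat.card (K.comap f) = Nat.card K * Nat.card f.ker := by
  have : Finite Q := Finite.of_surjective f hf
  have h1 := (K.comap f).card_mul_index
  rw [Subgroup.index_comap_of_surjective K hf] at h1
  have h2 := K.card_mul_index
  have h3 := f.ker.card_mul_index
  rw [Subgroup.index_ker, MonoidHom.range_eq_top.2 hf, Subgroup.card_top] at h3
  have h4 : K.index ≠ 0 := K.index_ne_zero_of_finite
  apply Nat.eq_of_mul_eq_mul_right (Nat.pos_of_ne_zero h4)
  rw [h1, ← h3, ← h2]; ring

/-- Here `K` is the preimage of the cyclic group generated by the class of `u` modulo `H`, and `k`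
is the order of that class. -/
lemma exists_coset_decomposition [Finite G] (H : Subgroup G) [H.Normal] {u : G} (hu : u ∉ H) :
    ∃ K : Subgroup G, H ≤ K ∧ u ∈ K ∧ ∃ k, 2 ≤ k ∧ Nat.card K = k * Nat.card H ∧
      ∀ g ∈ K, ∃ i < k, ∃ g' ∈ H, g = u ^ i * g' := by
  let f := QuotientGroup.mk' H
  have hf : Function.Surjective f := QuotientGroup.mk'_surjective H
  refine ⟨(Subgroup.zpowers (f u)).comap f, fun h hh => ?_, ?_, orderOf (f u), ?_, ?_, ?_⟩
  · have : f h = 1 := (QuotientGroup.eq_one_iff h).2 hh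
    simp [this, one_mem]
  · simp
  · have h1 : orderOf (f u) ≠ 1 := by
      rw [Ne, orderOf_eq_one_iff]
      exact fun h => hu ((QuotientGroup.eq_one_iff u).1 h)
    have := orderOf_pos (f u)
    omega
  · rw [card_comap_of_surjective f hf, Nat.card_zpowers, QuotientGroup.ker_mk']
  · intro g hg
    obtain ⟨i, hi, h⟩ := exists_pow_of_mem_zpowers (orderOf_pos (f u)) (Subgroup.mem_comap.1 hg)
    refine ⟨i, hi, (u ^ i)⁻¹ * g, ?_, by simp⟩
    rw [← QuotientGroup.eq]
    simpa [f] using h.symm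

end Cosets

section Extend

variable {G Q : Type*} [Group G] [CommGroup Q]

lemma IsTour.zpowers {x : G} {k : ℕ} (hk : orderOf x = k + 2) :
    IsTour (Subgroup.zpowers x) (x :: (List.replicate k x ++ [x])) := by
  have h : x :: (List.replicate k x ++ [x]) = List.replicate (k + 2) x := by
    rw [List.replicate_succ, List.replicate_succ']
  rw [h, ← hk]
  refine ⟨by simp [pow_orderOf_eq_one], by simp, fun g hg => ?_⟩
  obtain ⟨i, hi, rfl⟩ := exists_pow_of_mem_zpowers (by omega) hg
  simpa using mem_visits_replicate 1 x hi

/-- There is a tour of `H` with at least two letters, all of them in `S`, the first being `x`. -/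
def HasTour (S : Set G) (H : Subgroup G) (x : G) : Prop :=
  ∃ M y, (∀ z ∈ x :: (M ++ [y]), z ∈ S) ∧ IsTour H (x :: (M ++ [y]))

lemma mem_zigzag {S : Set G} (hS : ∀ z ∈ S, z⁻¹ ∈ S) {M : List G} {u : G} (hM : ∀ z ∈ M, z ∈ S)
    (hu : u ∈ S) : ∀ z ∈ zigzag M u, z ∈ S := by
  intro z hz
  simp only [zigzag, List.mem_append, List.mem_cons, List.mem_reverse, List.mem_map,
    List.not_mem_nil, or_false] at hz
  rcases hz with h | rfl | ⟨w, hw, rfl⟩ | rfl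
  exacts [hM z h, hu, hS _ (hM w hw), hu]

lemma mem_extendOdd {S : Set G} (hS : ∀ z ∈ S, z⁻¹ ∈ S) {M : List G} {x y u : G} {h : ℕ}
    (hM : ∀ z ∈ x :: (M ++ [y]), z ∈ S) (hu : u ∈ S) : ∀ z ∈ extendOdd x M y u h, z ∈ S := by
  intro z hz
  simp only [extendOdd, List.mem_cons, List.mem_append, List.mem_flatten, List.mem_replicate] at hz
  rcases hz with rfl | ⟨l, ⟨_, rfl⟩, h⟩ | h | rfl | ⟨_, rfl⟩
  · exact hM _ (by simp)
  · exact mem_zigzag hS (fun z hz => hM z (by simp [hz])) hu z h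
  · exact hM _ (by simp [h])
  · exact hM _ (by simp)
  · exact hS _ hu

lemma mem_extendEven {S : Set G} (hS : ∀ z ∈ S, z⁻¹ ∈ S) {M : List G} {x y u : G} {h : ℕ}
    (hM : ∀ z ∈ x :: (M ++ [y]), z ∈ S) (hu : u ∈ S) : ∀ z ∈ extendEven x M u h, z ∈ S := by
  intro z hz
  simp only [extendEven, List.mem_cons, List.mem_append, List.mem_flatten, List.mem_replicate,
    List.mem_reverse, List.mem_map] at hz
  rcases hz with rfl | ⟨l, ⟨_, rfl⟩, h⟩ | h | rfl | ⟨w, hw, rfl⟩ | rfl | ⟨_, rfl⟩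
  · exact hM _ (by simp)
  · exact mem_zigzag hS (fun z hz => hM z (by simp [hz])) hu z h
  · exact hM _ (by simp [h])
  · exact hu
  · exact hS _ (hM _ (by simp [hw]))
  · exact hS _ (hM _ (by simp))
  · exact hS _ hu

lemma hasTour_of_isTour {S : Set G} {H : Subgroup G} {x : G} {L : List G}
    (hL : IsTour H (x :: L)) (hS : ∀ z ∈ x :: L, z ∈ S) (hH : 2 ≤ Nat.card H) :
    HasTour S H x := by
  rcases List.eq_nil_or_concat L with rfl | ⟨M, y, rfl⟩
  · have := hL.length_eq
    simp at this; omega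
  · simp only [List.concat_eq_append] at *
    exact ⟨M, y, hS, hL⟩

/-- The smaller set `T` records the letters of the old tour, so that `u` has to commute only with
these; this is what makes the lemma usable in nonabelian groups. -/
lemma HasTour.extend {S T : Set G} (hS : ∀ z ∈ S, z⁻¹ ∈ S) {H K : Subgroup G} {x u : G} {k : ℕ}
    (hL : HasTour T H x) (hT : T ⊆ S) (hu : u ∈ S) (hcomm : ∀ z ∈ T, Commute u z)
    (hk : 1 ≤ k) (hcard : Nat.card K = k * Nat.card H)
    (hcov : ∀ g ∈ K, ∃ i < k, ∃ g' ∈ H, g = u ^ i * g') : HasTour S K x := by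
  obtain ⟨M, y, hM, hL⟩ := hL
  have hc : ∀ z ∈ x :: (M ++ [y]), Commute u z := fun z hz => hcomm z (hM z hz)
  have hM' : ∀ z ∈ x :: (M ++ [y]), z ∈ S := fun z hz => hT (hM z hz)
  have hH : 2 ≤ Nat.card K := by
    have := hL.length_eq
    simp only [List.length_cons, List.length_append, List.length_nil] at this
    rw [hcard]
    nlinarith
  rcases Nat.even_or_odd' k with ⟨h, rfl | rfl⟩
  · obtain ⟨h, rfl⟩ : ∃ j, h = j + 1 := ⟨h - 1, by omega⟩
    exact hasTour_of_isTour (hL.extendEven (h := h) hc hcard hcov) (mem_extendEven hS hM' hu) hH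
  · exact hasTour_of_isTour (hL.extendOdd (h := h) hc hcard hcov) (mem_extendOdd hS hM' hu) hH

lemma hasTour_zpowers {S : Set G} {x : G} (hx : x ∈ S) (h : 2 ≤ orderOf x) :
    HasTour S (Subgroup.zpowers x) x := by
  obtain ⟨k, hk⟩ : ∃ k, orderOf x = k + 2 := ⟨orderOf x - 2, by omega⟩
  refine ⟨_, _, fun z hz => ?_, IsTour.zpowers hk⟩
  simp only [List.mem_cons, List.mem_append, List.mem_replicate, List.not_mem_nil, or_false] at hz
  rcases hz with rfl | ⟨_, rfl⟩ | rfl <;> exact hx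

/-- Connected Cayley graphs of finite abelian groups are hamiltonian, with a prescribed first
edge. -/
lemma hasTour_top [Finite Q] {S : Set Q} (hS : ∀ z ∈ S, z⁻¹ ∈ S)
    (hgen : Subgroup.closure S = ⊤) {x : Q} (hx : x ∈ S) (hx1 : x ≠ 1) : HasTour S ⊤ x := by
  have hne : {H : Subgroup Q | HasTour S H x}.Nonempty := by
    refine ⟨_, hasTour_zpowers hx ?_⟩
    have := orderOf_pos x
    have : orderOf x ≠ 1 := by rwa [Ne, orderOf_eq_one_iff]
    omega
  -- A maximal subgroup with a tour contains every generator, since one outside it would allow an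
  -- extension.
  obtain ⟨H, hH⟩ := (Set.toFinite _).exists_maximal hne
  suffices S ⊆ H by
    have : H = ⊤ := by rw [eq_top_iff, ← hgen]; exact (Subgroup.closure_le H).2 this
    rw [← this]; exact hH.1
  intro u hu
  by_contra huH
  obtain ⟨K, hHK, huK, k, hk, hcard, hcov⟩ := exists_coset_decomposition H huH
  have hK : HasTour S K x :=
    HasTour.extend hS hH.1 subset_rfl hu (fun z _ => Commute.all u z) (by omega) hcard hcov
  exact huH (hH.2 hK hHK huK)

lemma exists_map_eq (f : G →* Q) {S : Set G} {L : List Q} (h : ∀ z ∈ L, z ∈ f '' S) :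
    ∃ L' : List G, L'.map f = L ∧ ∀ z ∈ L', z ∈ S := by
  induction L with
  | nil => exact ⟨[], by simp⟩
  | cons x L ih =>
    obtain ⟨L', rfl, hL'⟩ := ih fun z hz => h z (by simp [hz])
    obtain ⟨w, hw, rfl⟩ := h x (by simp)
    exact ⟨w :: L', by simp, by simpa [hw] using hL'⟩

/-- The tour of the quotient is lifted letter by letter, with the first lift prescribed; later that
letter is exchanged for another. -/
lemma exists_tour_map [Finite Q] (f : G →* Q) {S : Set G} (hf : Function.Surjective f)
    (hS : ∀ z ∈ S, z⁻¹ ∈ S) (hgen : Subgroup.closure S = ⊤) {x : G} (hx : x ∈ S)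
    (hx1 : f x ≠ 1) :
    ∃ L : List G, (∀ z ∈ x :: L, z ∈ S) ∧ IsTour ⊤ ((x :: L).map f) := by
  obtain ⟨M, y, hM, hL⟩ := hasTour_top (S := f '' S) (x := f x)
    (by rintro _ ⟨z, hz, rfl⟩; exact ⟨z⁻¹, hS z hz, by simp⟩)
    (by rw [← MonoidHom.map_closure, hgen]; exact Subgroup.map_top_of_surjective f hf)
    ⟨x, hx, rfl⟩ hx1
  obtain ⟨L, hL', hLS⟩ := exists_map_eq f (L := M ++ [y]) fun z hz => hM z (by simp [hz])
  exact ⟨L, by simpa [hx] using hLS, by rw [List.map_cons, hL']; exact hL⟩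

end Extend

/-! ### From tours to hamiltonian cycles -/

section Cayley

variable {G : Type*} [Group G]

lemma exists_walk_of_word {S : Set G} {L : List G} (hL : ∀ z ∈ L, z ≠ 1 ∧ (z ∈ S ∨ z⁻¹ ∈ S))
    (g : G) : ∃ w : (SimpleGraph.mulCayley S).Walk g (g * L.prod),
      w.support = visits g L ++ [g * L.prod] := by
  induction L generalizing g with
  | nil =>
    refine ⟨SimpleGraph.Walk.nil.copy rfl (by simp), ?_⟩
    rw [SimpleGraph.Walk.support_copy]
    simp [visits]
  | cons x L ih =>
    obtain ⟨w, hw⟩ := ih (fun z hz => hL z (by simp [hz])) (g * x)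
    obtain ⟨hx1, hxS⟩ := hL x (by simp)
    have hadj : (SimpleGraph.mulCayley S).Adj g (g * x) := by
      rw [SimpleGraph.mulCayley_adj]
      simpa [hx1] using hxS
    exact ⟨(SimpleGraph.Walk.cons hadj w).copy rfl (by simp [mul_assoc]),
      by simp [visits, hw, mul_assoc]⟩

lemma IsTour.nodup [Finite G] {L : List G} (hT : IsTour ⊤ L) : (visits 1 L).Nodup := by
  classical
  have := Fintype.ofFinite G
  rw [← Multiset.coe_nodup, ← Multiset.toFinset_card_eq_card_iff_nodup]
  have : (visits 1 L : Multiset G).toFinset = Finset.univ := by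
    ext g; simpa using hT.mem_visits g trivial
  rw [this]
  simp [hT.length_eq]

lemma exists_isHamiltonianCycle [Fintype G] [DecidableEq G] {S : Set G} {L : List G}
    (hL : ∀ z ∈ L, z ≠ 1 ∧ (z ∈ S ∨ z⁻¹ ∈ S)) (hT : IsTour ⊤ L) (hcard : 3 ≤ Fintype.card G) :
    ∃ (g : G) (c : (SimpleGraph.mulCayley S).Walk g g), c.IsHamiltonianCycle := by
  have hlen : L.length = Fintype.card G := by
    rw [hT.length_eq, Subgroup.card_top, Nat.card_eq_fintype_card]
  have hnd := hT.nodup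
  obtain ⟨x, L, rfl⟩ : ∃ x L', L = x :: L' := by
    cases L with
    | nil => simp at hlen; omega
    | cons x L => exact ⟨x, L, rfl⟩
  obtain ⟨w, hw⟩ := exists_walk_of_word (fun z hz => hL z (by simp [hz])) (1 * x) (L := L)
  have hend : 1 * x * L.prod = 1 := by simpa using hT.prod_eq
  obtain ⟨hx1, hxS⟩ := hL x (by simp)
  have hadj : (SimpleGraph.mulCayley S).Adj (1 * x * L.prod) (1 * x) := by
    rw [hend, SimpleGraph.mulCayley_adj]
    simpa [hx1, eq_comm] using hxS
  have hpath : w.IsPath := by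
    rw [SimpleGraph.Walk.isPath_def, hw, hend]
    rw [visits] at hnd
    exact (List.perm_append_singleton 1 _).nodup_iff.2 hnd
  have hwl : w.length + 1 = Fintype.card G := by
    rw [← SimpleGraph.Walk.length_support, hw, ← hlen]; simp
  refine ⟨_, SimpleGraph.Walk.cons hadj w, ?_⟩
  rw [SimpleGraph.Walk.isHamiltonianCycle_iff_isCycle_and_length_eq]
  refine ⟨(SimpleGraph.Walk.cons_isCycle_iff _ _).2 ⟨hpath, fun h => ?_⟩, by simpa using hwl⟩
  -- A path containing the edge between its two ends has length 1, which `3 ≤ |G|` excludes.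
  have := hpath.length_eq_one_of_mem_edges (by rwa [Sym2.eq_swap] at h)
  omega

end Cayley

/-! ### Affine coordinates and their existence for Z-groups -/

/-- Affine coordinates on a group: `α` is a surjective homomorphism onto a commutative group whose
kernel is identified with `ZMod n` by the crossed homomorphism `ν`, the action of the group on the
kernel being multiplication by `χ`. Moreover some group element acts on the kernel without
nontrivial fixed points. -/
structure AffineCoord (G Q : Type*) [Group G] [CommGroup Q] (n : ℕ) where
  α : G →* Q
  χ : G →* ZMod n
  ν : G → ZMod n
  ν_mul : ∀ g h, ν (g * h) = ν g + χ g * ν h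
  χ_eq_one : ∀ g, α g = 1 → χ g = 1
  eq_one : ∀ g, α g = 1 → ν g = 0 → g = 1
  surjective : Function.Surjective α
  card_eq : Nat.card G = Nat.card Q * n
  exists_isUnit : ∃ a, IsUnit (χ a - 1)

/-- Let `α a` generate `Q`, so every `χ g` is a power of `χ a`. Modulo the ideal generated by `χ a -
1` the crossed homomorphism `ν` becomes a homomorphism to an abelian group and kills commutators.
Since `ν c = 1`, the ideal is everything. -/
lemma exists_isUnit_sub_one {G Q : Type*} [Group G] [CommGroup Q] [Finite Q] [IsCyclic Q] {n : ℕ}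
    (α : G →* Q) (hα : Function.Surjective α) (χ : G →* ZMod n) (ν : G → ZMod n)
    (ν_mul : ∀ g h, ν (g * h) = ν g + χ g * ν h) (χ_eq : ∀ g, α g = 1 → χ g = 1)
    {c : G} (hc : c ∈ commutator G) (hc1 : ν c = 1) : ∃ a, IsUnit (χ a - 1) := by
  obtain ⟨q, hq⟩ := IsCyclic.exists_generator (α := Q)
  obtain ⟨a, rfl⟩ := hα q
  refine ⟨a, ?_⟩
  have hχ (g : G) : ∃ k : ℕ, χ g = χ a ^ k := by
    obtain ⟨k, -, hk⟩ := exists_pow_of_mem_zpowers (orderOf_pos (α a)) (hq (α g))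
    refine ⟨k, ?_⟩
    have h2 := map_mul χ (g * (a ^ k)⁻¹) (a ^ k)
    rwa [inv_mul_cancel_right, χ_eq (g * (a ^ k)⁻¹) (by simp [hk]), one_mul, map_pow] at h2
  let I : Ideal (ZMod n) := Ideal.span {χ a - 1}
  let π : ZMod n →+* ZMod n ⧸ I := Ideal.Quotient.mk I
  have hχI (g : G) : π (χ g) = 1 := by
    obtain ⟨k, hk⟩ := hχ g
    have : π (χ a) = 1 := by
      rw [← map_one π]
      exact Ideal.Quotient.eq.2 (Ideal.mem_span_singleton_self _)
    rw [hk, map_pow, this, one_pow]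
  let f : G →* Multiplicative (ZMod n ⧸ I) :=
    MonoidHom.mk' (fun g => Multiplicative.ofAdd (π (ν g))) fun g h => by
      rw [ν_mul, map_add, map_mul, hχI, one_mul, ofAdd_add]
  have h1 : π (ν c) = 0 := Abelianization.commutator_subset_ker f hc
  rw [hc1, Ideal.Quotient.eq_zero_iff_mem, Ideal.mem_span_singleton] at h1
  exact isUnit_of_dvd_one h1

open scoped IsMulCommutative Pointwise in
-- The commutator subgroup is cyclic, of order coprime to its index, so it has a complement `H`.
-- Every `g` is uniquely `d g` times an element of `H`, and `ν g` is the discrete logarithm of `d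
-- g`.
theorem IsZGroup.nonempty_affineCoord (G : Type*) [Group G] [Finite G] [IsZGroup G] :
    Nonempty (AffineCoord G (Abelianization G) (Nat.card (commutator G))) := by
  have hcyc : IsCyclic (commutator G) := IsZGroup.isCyclic_commutator G
  obtain ⟨H, hH⟩ := Subgroup.exists_right_complement'_of_coprime
    (IsZGroup.coprime_commutator_index (G := G))
  let act : MulDistribMulAction G (commutator G) :=
    MulDistribMulAction.compHom _ (MulAut.conjNormal : G →* MulAut (commutator G))
  have hact (g : G) (x : commutator G) : ((g • x : commutator G) : G) = g * x * g⁻¹ :=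
    MulAut.conjNormal_apply g x
  let χ : G →* ZMod (Nat.card (commutator G)) :=
    MulDistribMulAction.toMonoidHomZModOfIsCyclic (commutator G) G rfl
  let log (x : commutator G) : ZMod (Nat.card (commutator G)) :=
    ((zmodCyclicMulEquiv hcyc).symm x).toAdd
  have log_mul (x y) : log (x * y) = log x + log y := by simp [log]
  have log_smul (g : G) (x) : log (g • x) = χ g * log x := by
    have h : χ g = (((χ g).cast : ℤ) : ZMod (Nat.card (commutator G))) := by simp
    have := MulDistribMulAction.toMonoidHomZModOfIsCyclic_apply rfl g x _ h
    rw [this]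
    simp [log]
  have log_inj (x) (hx : log x = 0) : x = 1 := by
    simpa [log] using hx
  obtain ⟨c, hc⟩ : ∃ c, log c = 1 :=
    ⟨zmodCyclicMulEquiv hcyc (Multiplicative.ofAdd 1), by simp [log]⟩
  have χ_eq (g : G) (hg : g ∈ commutator G) : χ g = 1 := by
    have h1 : g • c = c := by
      have h2 : (⟨g, hg⟩ : commutator G) * c = c * ⟨g, hg⟩ := mul_comm _ _
      ext
      rw [hact, mul_inv_eq_iff_eq_mul]
      exact congrArg Subtype.val h2
    have := log_smul g c
    rwa [h1, hc, mul_one, eq_comm] at this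
  have hdec (g : G) : ∃ x : commutator G, (x : G)⁻¹ * g ∈ H := by
    have h := hH.mul_eq
    have : g ∈ ((commutator G : Set G) * (H : Set G)) := by rw [h]; trivial
    obtain ⟨x, hx, y, hy, rfl⟩ := this
    exact ⟨⟨x, hx⟩, by simpa using hy⟩
  choose d hd using hdec
  have hd_unique (g : G) (x : commutator G) (hx : (x : G)⁻¹ * g ∈ H) : d g = x := by
    have h1 : (x : G)⁻¹ * d g ∈ H := by
      have := H.mul_mem hx (H.inv_mem (hd g))
      simpa using this
    have h2 : (x : G)⁻¹ * d g ∈ commutator G := mul_mem (inv_mem x.2) (d g).2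
    have h3 := hH.disjoint.le_bot (Subgroup.mem_inf.2 ⟨h2, h1⟩)
    rw [Subgroup.mem_bot, inv_mul_eq_one] at h3
    exact Subtype.ext h3.symm
  have ν_mul (g h : G) : log (d (g * h)) = log (d g) + χ g * log (d h) := by
    have : d (g * h) = d g * (((d g : G)⁻¹ * g) • d h) := by
      apply hd_unique
      have := H.mul_mem (hd g) (hd h)
      convert this using 1
      push_cast
      rw [hact]
      group
    rw [this, log_mul, log_smul, map_mul, χ_eq _ (inv_mem (d g).2), one_mul]
  have hα (g : G) : Abelianization.of g = 1 ↔ g ∈ commutator G := by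
    rw [← MonoidHom.mem_ker, Abelianization.ker_of]
  refine ⟨⟨Abelianization.of, χ, fun g => log (d g), ν_mul, fun g hg => χ_eq g ((hα g).1 hg),
    fun g hg h => ?_, QuotientGroup.mk'_surjective _,
    Subgroup.card_eq_card_quotient_mul_card_subgroup _, ?_⟩⟩
  · have := hd g
    rw [log_inj _ h] at this
    have h3 := hH.disjoint.le_bot (Subgroup.mem_inf.2 ⟨(hα g).1 hg, by simpa using this⟩)
    simpa using h3
  · have : Finite (Abelianization G) :=
      Finite.of_surjective _ (QuotientGroup.mk'_surjective (commutator G))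
    have hdc : d c = c := hd_unique _ _ (by simp [one_mem])
    exact exists_isUnit_sub_one (ν := fun g => log (d g)) Abelianization.of
      (QuotientGroup.mk'_surjective _) χ ν_mul (fun g hg => χ_eq g ((hα g).1 hg)) c.2
      (show log (d c) = 1 by rw [hdc, hc])

/-! ### Calculus in affine coordinates and words with controlled product -/

/-- The word that runs along `k` letters `t` before each letter of `L`. -/
def interleave {G : Type*} (t : G) (k : ℕ) (L : List G) : List G :=
  L.flatMap fun x => List.replicate k t ++ [x]

lemma length_interleave {G : Type*} (t : G) (k : ℕ) (L : List G) :
    (interleave t k L).length = L.length * (k + 1) := by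
  simp [interleave, List.length_flatMap]

lemma mem_interleave {G : Type*} {S : Set G} {L : List G} {t : G} (k : ℕ) (hS : ∀ z ∈ L, z ∈ S)
    (htS : t ∈ S) : ∀ z ∈ interleave t k L, z ∈ S := by
  intro z h
  simp only [interleave, List.mem_flatMap, List.mem_append, List.mem_replicate,
    List.mem_singleton] at h
  obtain ⟨w, hw, ⟨_, rfl⟩ | rfl⟩ := h
  exacts [htS, hS _ hw]

namespace AffineCoord

variable {G Q : Type*} [Group G] [CommGroup Q] {n : ℕ} (D : AffineCoord G Q n)

@[simp] lemma ν_one : D.ν 1 = 0 := by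
  have := D.ν_mul 1 1
  simpa using this

lemma χ_mul_inv (g : G) : D.χ g * D.χ g⁻¹ = 1 := by rw [← map_mul]; simp

lemma isUnit_χ (g : G) : IsUnit (D.χ g) := IsUnit.of_mul_eq_one _ (D.χ_mul_inv g)

lemma ν_inv (g : G) : D.ν g⁻¹ = -(D.χ g⁻¹ * D.ν g) := by
  have := D.ν_mul g⁻¹ g
  rw [inv_mul_cancel, ν_one] at this
  linear_combination -this

lemma ν_pow_of_eq_zero {g : G} (h : D.ν g = 0) (k : ℕ) : D.ν (g ^ k) = 0 := by
  induction k with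
  | zero => simp
  | succ k ih => rw [pow_succ, ν_mul, ih, h]; simp

lemma ν_inv_of_eq_zero {g : G} (h : D.ν g = 0) : D.ν g⁻¹ = 0 := by
  rw [ν_inv, h]; simp

lemma ν_pow_of_χ_eq_one {g : G} (h : D.χ g = 1) (k : ℕ) : D.ν (g ^ k) = k * D.ν g := by
  induction k with
  | zero => simp
  | succ k ih => rw [pow_succ, ν_mul, ih, map_pow, h]; push_cast; ring

lemma mul_ν_pow (g : G) (k : ℕ) : (D.χ g - 1) * D.ν (g ^ k) = (D.χ g ^ k - 1) * D.ν g := by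
  induction k with
  | zero => simp
  | succ k ih => rw [pow_succ, ν_mul, mul_add, ih, map_pow]; ring

lemma χ_congr {g h : G} (hα : D.α g = D.α h) : D.χ g = D.χ h := by
  have h1 : D.χ (g * h⁻¹) = 1 := D.χ_eq_one _ (by simp [hα])
  have := D.χ_mul_inv h
  rw [map_mul] at h1
  linear_combination D.χ h * h1 - D.χ g * this

lemma ext {g h : G} (hα : D.α g = D.α h) (hν : D.ν g = D.ν h) : g = h := by
  have h1 : D.α (g⁻¹ * h) = 1 := by simp [hα]
  have h2 : D.ν (g⁻¹ * h) = 0 := by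
    rw [ν_mul, ← hν, ← ν_mul]; simp
  exact inv_mul_eq_one.1 (D.eq_one _ h1 h2)

/-- The map to pairs `(α g, ν g)` is injective between finite sets of equal size. -/
lemma exists_eq [Finite G] [NeZero n] (q : Q) (y : ZMod n) : ∃ g, D.α g = q ∧ D.ν g = y := by
  have : Finite Q := Finite.of_surjective _ D.surjective
  have hinj : Function.Injective fun g => (D.α g, D.ν g) := fun g h hgh =>
    D.ext (congrArg Prod.fst hgh) (congrArg Prod.snd hgh)
  have hbij := (Nat.bijective_iff_injective_and_card _).2
    ⟨hinj, by simp [Nat.card_prod, D.card_eq]⟩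
  obtain ⟨g, hg⟩ := hbij.2 (q, y)
  exact ⟨g, congrArg Prod.fst hg, congrArg Prod.snd hg⟩

lemma card_ker [Finite G] : Nat.card D.α.ker = n := by
  have h3 := D.α.ker.card_mul_index
  rw [Subgroup.index_ker, MonoidHom.range_eq_top.2 D.surjective, Subgroup.card_top, D.card_eq,
    mul_comm] at h3
  have : Finite Q := Finite.of_surjective _ D.surjective
  exact Nat.eq_of_mul_eq_mul_left Nat.card_pos h3

/-- Change of the base point of the affine coordinates. -/
@[simps] def gauge (w : ZMod n) : AffineCoord G Q n where
  α := D.α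
  χ := D.χ
  ν g := D.ν g + (D.χ g - 1) * w
  ν_mul g h := by rw [ν_mul, map_mul]; ring
  χ_eq_one := D.χ_eq_one
  eq_one g hα hν := D.eq_one g hα (by simpa [D.χ_eq_one g hα] using hν)
  surjective := D.surjective
  card_eq := D.card_eq
  exists_isUnit := D.exists_isUnit

lemma pow_eq_one {z : G} (hz : D.α z = 1) (k : ℕ) : z ^ k = 1 ↔ k * D.ν z = 0 := by
  rw [← D.ν_pow_of_χ_eq_one (D.χ_eq_one z hz)]
  exact ⟨fun h => by simp [h], fun h => D.eq_one _ (by simp [hz]) h⟩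

lemma orderOf_eq {z : G} (hz : D.α z = 1) (hu : IsUnit (D.ν z)) : orderOf z = n := by
  refine dvd_antisymm ?_ ?_
  · rw [orderOf_dvd_iff_pow_eq_one, D.pow_eq_one hz]; simp
  · rw [← ZMod.natCast_eq_zero_iff, ← hu.mul_left_eq_zero, ← D.pow_eq_one hz, pow_orderOf_eq_one]

lemma exists_mem_visits {K : Subgroup Q} {L : List G} (hL : IsTour K (L.map D.α)) {g : G}
    (hg : D.α g ∈ K) : ∃ v ∈ visits 1 L, D.α v = D.α g := by
  have := hL.mem_visits _ hg
  rw [← map_one D.α, visits_map, List.mem_map] at this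
  exact this

/-- The factor group lemma for a tour whose product generates the kernel of `α`. -/
lemma exists_tour_comap [Finite G] [NeZero n] {S : Set G} {K : Subgroup Q} {L : List G}
    (hS : ∀ z ∈ L, z ∈ S) (hL : IsTour K (L.map D.α)) (hu : IsUnit (D.ν L.prod)) :
    ∃ L', (∀ z ∈ L', z ∈ S) ∧ IsTour (K.comap D.α) L' := by
  have hα : D.α L.prod = 1 := by rw [map_list_prod]; exact hL.prod_eq
  have hn := D.orderOf_eq hα hu
  refine ⟨_, fun z hz => ?_, IsTour.of_powers (L := L) ?_ fun g hg => ?_⟩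
  · simp only [List.mem_flatten, List.mem_replicate] at hz
    obtain ⟨l, ⟨_, rfl⟩, h⟩ := hz
    exact hS z h
  · rw [hn, card_comap_of_surjective _ D.surjective, D.card_ker, ← hL.length_eq, List.length_map]
  · obtain ⟨v, hv, hvg⟩ := D.exists_mem_visits hL hg
    obtain ⟨e, he⟩ := hu.exists_left_inv
    -- The product of `L` has a unit as `ν`-coordinate, so a suitable power moves `v` to `g` inside
    -- its coset.
    refine ⟨((D.ν g - D.ν v) * e).val, v, hv, D.ext (by simp [hα, hvg]) ?_⟩
    have h1 := D.χ_eq_one _ hα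
    rw [ν_mul, D.ν_pow_of_χ_eq_one h1, map_pow, h1, ZMod.natCast_zmod_val]
    linear_combination -(D.ν g - D.ν v) * he

lemma exists_tour_of_isUnit [Finite G] [NeZero n] {S : Set G} {L : List G}
    (hS : ∀ z ∈ L, z ∈ S) (hL : IsTour ⊤ (L.map D.α)) (hu : IsUnit (D.ν L.prod)) :
    ∃ L', (∀ z ∈ L', z ∈ S) ∧ IsTour (⊤ : Subgroup G) L' := by
  simpa using D.exists_tour_comap hS hL hu

/-- The sum runs once over `Q`, so it is invariant under multiplication by `χ a`; as `χ a - 1` is a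
unit for some `a`, it vanishes. Hence inserting powers of a kernel element before each letter does
not change the product of a tour. -/
lemma sum_χ_visits [Finite G] {L : List G} (hL : IsTour ⊤ (L.map D.α)) :
    ((visits 1 L).map D.χ).sum = 0 := by
  classical
  have : Finite Q := Finite.of_surjective _ D.surjective
  have := Fintype.ofFinite Q
  let X (q : Q) : ZMod n := D.χ (Function.surjInv D.surjective q)
  have hX (g : G) : X (D.α g) = D.χ g := D.χ_congr (Function.surjInv_eq D.surjective _)
  have hnd := hL.nodup
  have huniv : (visits 1 (L.map D.α)).toFinset = Finset.univ := by
    ext q; simpa using hL.mem_visits q trivial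
  have h1 : ((visits 1 L).map D.χ).sum = ∑ q, X q := by
    rw [← huniv, List.sum_toFinset _ hnd, ← map_one D.α, visits_map, List.map_map]
    congr 1
    exact List.map_congr_left fun g _ => (hX g).symm
  obtain ⟨a, ha⟩ := D.exists_isUnit
  have h2 : ∑ q, X q = D.χ a * ∑ q, X q := by
    rw [Finset.mul_sum, ← Equiv.sum_comp (Equiv.mulLeft (D.α a))]
    refine Finset.sum_congr rfl fun q _ => ?_
    obtain ⟨g, rfl⟩ := D.surjective q
    rw [Equiv.coe_mulLeft, hX]
    change X (D.α a * D.α g) = _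
    rw [← map_mul, hX, map_mul]
  rw [h1]
  refine (ha.mul_right_eq_zero).1 ?_
  linear_combination -h2

lemma ν_interleave {t : G} (ht : D.α t = 1) (k : ℕ) (L : List G) :
    D.α (interleave t k L).prod = D.α L.prod ∧
    D.ν (interleave t k L).prod =
      D.ν L.prod + k * D.ν t * ((visits 1 L).map D.χ).sum := by
  induction L with
  | nil => simp [interleave, visits]
  | cons x L ih =>
    have hχ := D.χ_eq_one t ht
    have h0 : interleave t k (x :: L) = List.replicate k t ++ x :: interleave t k L := by
      simp [interleave]
    have h2 : visits (1 * x) L = (visits 1 L).map (x * ·) := by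
      rw [← visits_mul]; simp
    constructor
    · simp [h0, ih.1, ht]
    · have h3 : ((List.map (fun x_1 => x * x_1) (visits 1 L)).map D.χ).sum =
          D.χ x * ((visits 1 L).map D.χ).sum := by
        rw [List.map_map, ← List.sum_map_mul_left]
        congr 1
        exact List.map_congr_left fun g _ => by simp
      rw [h0, visits, h2, List.map_cons, List.sum_cons, h3]
      simp only [List.prod_append, List.prod_cons, List.prod_replicate, ν_mul, ih.2,
        D.ν_pow_of_χ_eq_one hχ, map_pow, hχ, map_one]
      ring

lemma α_interleave (t : G) (k : ℕ) (L : List G) :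
    D.α (interleave t k L).prod = D.α L.prod * D.α t ^ (k * L.length) := by
  induction L with
  | nil => simp [interleave]
  | cons x L ih =>
    have h0 : interleave t k (x :: L) = List.replicate k t ++ x :: interleave t k L := by
      simp [interleave]
    rw [h0]
    simp only [List.prod_append, List.prod_replicate, List.prod_cons, map_mul, map_pow, ih,
      List.length_cons, mul_add, mul_one, pow_add]
    ac_rfl

lemma mem_visits_interleave {t g v : G} {k : ℕ} {L : List G} (hv : v ∈ visits g L) :
    ∃ u m, D.α u = D.α v * D.α t ^ m ∧ ∀ j ≤ k, u * t ^ j ∈ visits g (interleave t k L) := by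
  obtain ⟨A, B, rfl, hB, rfl⟩ := mem_visits_iff.1 hv
  obtain ⟨x, B, rfl⟩ := List.exists_cons_of_ne_nil hB
  refine ⟨g * (interleave t k A).prod, k * A.length,
    by rw [map_mul, α_interleave, map_mul, mul_assoc], fun j hj => ?_⟩
  have : interleave t k (A ++ x :: B) =
      interleave t k A ++ (List.replicate j t ++ (List.replicate (k - j) t ++ x ::
        interleave t k B)) := by
    rw [← List.append_assoc (List.replicate j t), ← List.replicate_add,
      show j + (k - j) = k by omega]
    simp [interleave]
  rw [mem_visits_iff]
  exact ⟨interleave t k A ++ List.replicate j t, _, by rw [this, List.append_assoc], by simp,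
    by simp [mul_assoc]⟩

/-- Each vertex of the walk is replaced by a run through `u * t ^ j`, `j ≤ k`. The runs cover the
part of the kernel coming from `t`, the powers of the unchanged product cover the rest, and `hspan`
says that together they suffice. -/
lemma exists_tour_interleave [Finite G] [NeZero n] {S : Set G} {L : List G} {t : G} {k : ℕ}
    (hS : ∀ z ∈ L, z ∈ S) (htS : t ∈ S) (hL : IsTour ⊤ (L.map D.α)) (ht : D.α t = 1)
    (hkt : ((k + 1 : ℕ) : ZMod n) * D.ν t = 0) (hn : orderOf L.prod * (k + 1) = n)
    (hspan : ∀ y : ZMod n, ∃ i j, y = i * D.ν L.prod + j * D.ν t) :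
    ∃ L', (∀ z ∈ L', z ∈ S) ∧ IsTour (⊤ : Subgroup G) L' := by
  have hα : D.α L.prod = 1 := by rw [map_list_prod]; exact hL.prod_eq
  have hprod : (interleave t k L).prod = L.prod := by
    obtain ⟨h1, h2⟩ := D.ν_interleave ht k L
    exact D.ext h1 (by rw [h2, D.sum_χ_visits hL]; simp)
  refine ⟨_, fun z hz => ?_, IsTour.of_powers (L := interleave t k L) ?_ fun g _ => ?_⟩
  · simp only [List.mem_flatten, List.mem_replicate] at hz
    obtain ⟨l, ⟨_, rfl⟩, h⟩ := hz
    exact mem_interleave k hS htS z h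
  · have := hL.length_eq
    rw [List.length_map, Subgroup.card_top] at this
    rw [hprod, length_interleave, Subgroup.card_top, D.card_eq, this, ← hn]; ring
  · obtain ⟨v, hv, hvg⟩ := D.exists_mem_visits hL (g := g) trivial
    obtain ⟨u, m, hu, hmem⟩ := D.mem_visits_interleave (t := t) (k := k) hv
    rw [ht, one_pow, mul_one] at hu
    have hχ := D.χ_eq_one t ht
    have hχz := D.χ_eq_one _ hα
    obtain ⟨e, he⟩ := (D.isUnit_χ u).exists_left_inv
    obtain ⟨i, j, hij⟩ := hspan (D.ν g - D.ν u)
    have hmod : (((e * j).val % (k + 1) : ℕ) : ZMod n) * D.ν t = e * j * D.ν t := by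
      have h1 := congrArg (Nat.cast (R := ZMod n)) (Nat.div_add_mod (e * j).val (k + 1))
      rw [ZMod.natCast_zmod_val, Nat.cast_add, Nat.cast_mul] at h1
      linear_combination D.ν t * h1 - (((e * j).val / (k + 1) : ℕ) : ZMod n) * hkt
    refine ⟨i.val, _, hmem _ (Nat.lt_succ_iff.1 (Nat.mod_lt (e * j).val (Nat.succ_pos k))),
      D.ext (by simp [hprod, hα, ht, hu, hvg]) ?_⟩
    rw [hprod, ν_mul, ν_mul, D.ν_pow_of_χ_eq_one hχz, D.ν_pow_of_χ_eq_one hχ, map_pow, hχz, hmod,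
      ZMod.natCast_zmod_val]
    linear_combination hij - j * D.ν t * he

/-- The tour of a cyclic group with generator `σ` that uses the letter `σ ^ (k + 1)` twice. -/
lemma _root_.isTour_two_chords {C : Type*} [Group C] {σ : C} {k l : ℕ}
    (hσ : orderOf σ = k + l + 2) :
    IsTour (Subgroup.zpowers σ)
      (σ ^ (k + 1) :: (List.replicate k σ⁻¹ ++ σ ^ (k + 1) :: List.replicate l σ)) := by
  -- In exponents the walk is `0, k + 1, k, ..., 1, k + 2, ..., k + l + 1, 0`.
  have h1 : σ ^ (k + 1) * (σ⁻¹) ^ k = σ := by rw [pow_succ']; simp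
  refine ⟨?_, ?_, fun g hg => ?_⟩
  · simp only [List.prod_cons, List.prod_append, List.prod_replicate]
    rw [← mul_assoc, h1, ← mul_assoc, ← pow_succ', ← pow_add,
      show k + 1 + 1 + l = k + l + 2 by ring, ← hσ, pow_orderOf_eq_one]
  · simp [hσ]; ring
  · obtain ⟨i, hi, rfl⟩ := exists_pow_of_mem_zpowers (by omega) hg
    rw [visits, List.mem_cons, one_mul]
    rcases Nat.eq_zero_or_pos i with rfl | hi0
    · simp
    right
    rcases Nat.lt_or_ge i 2 with hi2 | hi2
    · obtain rfl : i = 1 := by omega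
      refine mem_visits_append_right ?_
      rw [List.prod_replicate, h1]
      simp [visits]
    rcases Nat.lt_or_ge (k + 1) i with hik | hik
    · refine mem_visits_append_right ?_
      rw [visits]
      refine List.mem_cons_of_mem _ ?_
      have := mem_visits_replicate (σ ^ (k + 2)) σ (show i - (k + 2) < l by omega)
      rw [← pow_add, show k + 2 + (i - (k + 2)) = i by omega] at this
      rwa [List.prod_replicate, h1, ← pow_succ']
    · refine mem_visits_append_left _ ?_
      have := mem_visits_replicate (σ ^ (k + 1)) σ⁻¹ (show k + 1 - i < k by omega)
      rwa [inv_pow, ← pow_sub _ (by omega), show k + 1 - (k + 1 - i) = i by omega] at this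

/-- As `ν s = 0`, only the two letters `t` contribute: the first with coefficient `1`, the second
with `χ (t * s⁻¹ ^ k) = χ s`. The product is useful as soon as `1 + χ s` is a unit. -/
lemma exists_two_chords {S : Set G} (hS : ∀ z ∈ S, z⁻¹ ∈ S) {s t : G} (hs : s ∈ S) (ht : t ∈ S)
    {k l : ℕ} (hst : D.α t = D.α s ^ (k + 1)) (hk : orderOf (D.α s) = k + l + 2)
    (hν : D.ν s = 0) :
    ∃ L : List G, (∀ z ∈ L, z ∈ S) ∧ IsTour (Subgroup.zpowers (D.α s)) (L.map D.α) ∧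
      D.ν L.prod = (1 + D.χ s) * D.ν t := by
  refine ⟨t :: (List.replicate k s⁻¹ ++ t :: List.replicate l s), ?_, ?_, ?_⟩
  · intro z hz
    simp only [List.mem_cons, List.mem_append, List.mem_replicate] at hz
    rcases hz with rfl | ⟨_, rfl⟩ | rfl | ⟨_, rfl⟩
    exacts [ht, hS _ hs, ht, hs]
  · simpa [hst] using isTour_two_chords hk
  · have h1 : D.χ t = D.χ s ^ (k + 1) := by
      rw [← map_pow]; exact D.χ_congr (by simp [hst])
    have h2 : D.χ s ^ k * D.χ s⁻¹ ^ k = 1 := by rw [← mul_pow, D.χ_mul_inv, one_pow]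
    simp only [List.prod_cons, List.prod_append, List.prod_replicate, ν_mul, map_pow,
      D.ν_pow_of_eq_zero hν, D.ν_pow_of_eq_zero (D.ν_inv_of_eq_zero hν), h1]
    linear_combination D.χ s * D.ν t * h2

end AffineCoord

/-! ### Abelianization of prime order -/

lemma ZMod.isUnit_of_mul_ne_zero {n q r : ℕ} (hn : n = q * r) (hq : q.Prime) (hr : r.Prime)
    {x : ZMod n} (h1 : (q : ZMod n) * x ≠ 0) (h2 : (r : ZMod n) * x ≠ 0) : IsUnit x := by
  subst hn
  have : NeZero (q * r) := ⟨mul_ne_zero hq.ne_zero hr.ne_zero⟩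
  rw [← ZMod.natCast_zmod_val x, ← Nat.cast_mul, Ne, ZMod.natCast_eq_zero_iff] at h1 h2
  rw [← ZMod.natCast_zmod_val x, ZMod.isUnit_iff_coprime]
  refine Nat.Coprime.mul_right (Nat.Coprime.symm ?_) (Nat.Coprime.symm ?_)
  · rw [hq.coprime_iff_not_dvd]
    exact fun h => h2 ((dvd_of_eq (mul_comm q r)).trans (Nat.mul_dvd_mul_left r h))
  · rw [hr.coprime_iff_not_dvd]
    exact fun h => h1 (Nat.mul_dvd_mul_left q h)

namespace AffineCoord

variable {G Q : Type*} [Group G] [CommGroup Q] {n : ℕ} (D : AffineCoord G Q n)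

section PrimeIndex

lemma orderOf_of_prime (hp : (Nat.card Q).Prime) {x : Q} (hx : x ≠ 1) :
    orderOf x = Nat.card Q :=
  (hp.eq_one_or_self_of_dvd _ (orderOf_dvd_natCard x)).resolve_left (by simpa using hx)

lemma mem_zpowers_of_orderOf_eq [Finite Q] {x : Q} (hx : orderOf x = Nat.card Q) (y : Q) :
    y ∈ Subgroup.zpowers x := by
  have : Subgroup.zpowers x = ⊤ :=
    Subgroup.eq_top_of_card_eq _ (by rw [Nat.card_zpowers, hx])
  rw [this]; trivial

/-- Some `χ a - 1` is a unit, and `χ a` is a power of `χ g`, so `χ g - 1` divides that unit. -/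
lemma isUnit_χ_sub_one [Finite G] {g : G} (hg : orderOf (D.α g) = Nat.card Q) :
    IsUnit (D.χ g - 1) := by
  have : Finite Q := Finite.of_surjective _ D.surjective
  obtain ⟨a, ha⟩ := D.exists_isUnit
  obtain ⟨k, -, hk⟩ := exists_pow_of_mem_zpowers (orderOf_pos (D.α g))
    (mem_zpowers_of_orderOf_eq hg (D.α a))
  rw [D.χ_congr (h := g ^ k) (by simpa using hk), map_pow] at ha
  have := sub_dvd_pow_sub_pow (D.χ g) 1 k
  rw [one_pow] at this
  exact isUnit_of_dvd_unit this ha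

lemma isUnit_χ_sub_one_of_prime [Finite G] (hp : (Nat.card Q).Prime) {g : G} (hg : D.α g ≠ 1) :
    IsUnit (D.χ g - 1) :=
  D.isUnit_χ_sub_one (orderOf_of_prime hp hg)

lemma exists_word_of_prime [Finite G] (hp : (Nat.card Q).Prime) {S : Set G}
    (hS : ∀ z ∈ S, z⁻¹ ∈ S) {s t : G} (hs : s ∈ S) (ht : t ∈ S) (hs1 : D.α s ≠ 1)
    (ht1 : D.α t ≠ 1) (hν : D.ν s = 0) :
    ∃ L : List G, (∀ z ∈ L, z ∈ S) ∧ IsTour ⊤ (L.map D.α) ∧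
      ∃ e, IsUnit e ∧ D.ν L.prod = e * D.ν t := by
  have : Finite Q := Finite.of_surjective _ D.surjective
  have hord := orderOf_of_prime hp hs1
  have htop : Subgroup.zpowers (D.α s) = ⊤ :=
    eq_top_iff.2 fun y _ => mem_zpowers_of_orderOf_eq hord y
  obtain ⟨i, hi, hst⟩ := exists_pow_of_mem_zpowers (orderOf_pos (D.α s))
    (mem_zpowers_of_orderOf_eq hord (D.α t))
  have hi0 : i ≠ 0 := by rintro rfl; exact ht1 (by simpa using hst)
  rcases Nat.lt_or_ge i 2 with hi2 | hi2
  · obtain rfl : i = 1 := by omega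
    rw [pow_one] at hst
    obtain ⟨k, hk⟩ : ∃ k, orderOf (D.α s) = k + 2 := ⟨orderOf (D.α s) - 2, by omega⟩
    refine ⟨t :: (List.replicate k s ++ [s]), fun z hz => ?_, ?_, 1, isUnit_one, ?_⟩
    · simp only [List.mem_cons, List.mem_append, List.mem_replicate, List.not_mem_nil,
        or_false] at hz
      rcases hz with rfl | ⟨_, rfl⟩ | rfl
      exacts [ht, hs, hs]
    · simpa [hst, htop] using IsTour.zpowers hk
    · simp [ν_mul, D.ν_pow_of_eq_zero hν, hν]
  · obtain ⟨k, rfl⟩ : ∃ k, i = k + 1 := ⟨i - 1, by omega⟩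
    obtain ⟨l, hl⟩ : ∃ l, orderOf (D.α s) = k + l + 2 :=
      ⟨orderOf (D.α s) - (k + 2), by omega⟩
    obtain ⟨L, hLS, hL, hLν⟩ := D.exists_two_chords hS hs ht hst hl hν
    refine ⟨L, hLS, htop ▸ hL, 1 + D.χ s, ?_, hLν⟩
    -- The case `i ≥ 2` forces `α s` to have order at least 3, so `χ s ^ 2 - 1` is a unit and so is
    -- its factor `1 + χ s`.
    have h2 : D.α (s ^ 2) ≠ 1 := by
      rw [map_pow]
      intro h
      have := Nat.le_of_dvd (by norm_num) (orderOf_dvd_of_pow_eq_one h)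
      omega
    have h3 := D.isUnit_χ_sub_one_of_prime hp h2
    rw [map_pow] at h3
    exact isUnit_of_dvd_unit ⟨D.χ s - 1, by ring⟩ h3

/-- Replacing the last letter of a tour of the kernel by `s` gives a word that visits the whole
kernel and whose product lies over `α s`. That product has order `|Q|` because `χ s - 1` is a unit,
so its powers represent the cosets of the kernel. -/
lemma exists_tour_of_ker [Finite G] [NeZero n] (hp : (Nat.card Q).Prime) {S : Set G} {x s : G}
    (hs : s ∈ S) (hs1 : D.α s ≠ 1) (hker : HasTour {z ∈ S | D.α z = 1} D.α.ker x) :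
    ∃ L, (∀ z ∈ L, z ∈ S) ∧ IsTour (⊤ : Subgroup G) L := by
  have : Finite Q := Finite.of_surjective _ D.surjective
  obtain ⟨M, y, hM, hL⟩ := hker
  have hW : D.α (x :: M).prod = 1 := by
    rw [map_list_prod]
    refine List.prod_eq_one fun c hc => ?_
    obtain ⟨z, hz, rfl⟩ := List.mem_map.1 hc
    refine (hM z ?_).2
    simp only [List.mem_cons, List.mem_append] at hz ⊢
    tauto
  let W := x :: (M ++ [s])
  have hz : D.α W.prod = D.α s := by
    rw [show W = (x :: M) ++ [s] from rfl, List.prod_append, map_mul, hW]; simp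
  have hpow : W.prod ^ Nat.card Q = 1 := by
    have h1 : D.α (W.prod ^ Nat.card Q) = 1 := by rw [map_pow, pow_card_eq_one']
    refine D.eq_one _ h1 ?_
    have h2 := D.mul_ν_pow W.prod (Nat.card Q)
    rw [← map_pow, D.χ_eq_one _ h1, sub_self, zero_mul] at h2
    exact (D.isUnit_χ_sub_one_of_prime hp (hz ▸ hs1)).mul_right_eq_zero.1 h2
  have hord : orderOf W.prod = Nat.card Q := by
    refine (hp.eq_one_or_self_of_dvd _ (orderOf_dvd_of_pow_eq_one hpow)).resolve_left fun h => ?_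
    rw [orderOf_eq_one_iff.1 h, map_one] at hz
    exact hs1 hz.symm
  refine ⟨_, fun z hz => ?_, IsTour.of_powers (L := W) ?_ fun g _ => ?_⟩
  · simp only [List.mem_flatten, List.mem_replicate] at hz
    obtain ⟨l, ⟨_, rfl⟩, h⟩ := hz
    simp only [W, List.mem_cons, List.mem_append, List.not_mem_nil, or_false] at h
    rcases h with rfl | h | rfl
    · exact (hM _ (by simp)).1
    · exact (hM _ (by simp [h])).1
    · exact hs
  · have := hL.length_eq
    rw [D.card_ker] at this
    rw [hord, Subgroup.card_top, D.card_eq, ← this]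
    simp [W, mul_comm]
  · obtain ⟨i, -, hi⟩ := exists_pow_of_mem_zpowers (orderOf_pos (D.α s))
      (mem_zpowers_of_orderOf_eq (orderOf_of_prime hp hs1) (D.α g))
    refine ⟨i, (W.prod ^ i)⁻¹ * g, ?_, by simp⟩
    have hmem : (W.prod ^ i)⁻¹ * g ∈ D.α.ker := by
      rw [MonoidHom.mem_ker, map_mul, map_inv, map_pow, hz, hi]; simp
    rcases hL.eq_one_or_prefix hmem with h | ⟨A, B, rfl, h⟩
    · rw [h]; simp [W, visits]
    · rw [h, mem_visits_iff]
      exact ⟨x :: A, B ++ [s], by simp [W], by simp, by simp⟩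

lemma hasTour_ker_of_isUnit [Finite G] [NeZero n] {S : Set G} {x : G} (hx : x ∈ S)
    (hx1 : D.α x = 1) (hu : IsUnit (D.ν x)) (hn : 2 ≤ n) :
    HasTour {z ∈ S | D.α z = 1} D.α.ker x := by
  have hord := D.orderOf_eq hx1 hu
  have : Subgroup.zpowers x = D.α.ker :=
    Subgroup.eq_of_le_of_card_ge (by simpa [Subgroup.zpowers_le] using hx1)
      (by rw [Nat.card_zpowers, hord, D.card_ker])
  rw [← this]
  exact hasTour_zpowers ⟨hx, hx1⟩ (hord ▸ hn)

end PrimeIndex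

section TwoPrimes

variable {q r : ℕ}

/-- The `ν`-coordinate is nonzero modulo `q` and zero modulo `r`. -/
def IsPrimePart (q r : ℕ) (t : G) : Prop :=
  (r : ZMod n) * D.ν t ≠ 0 ∧ (q : ZMod n) * D.ν t = 0

variable {D} in
lemma IsPrimePart.orderOf_eq (hq : q.Prime) {t : G} (h : D.IsPrimePart q r t)
    (ht : D.α t = 1) : orderOf t = q := by
  refine (hq.eq_one_or_self_of_dvd _ (orderOf_dvd_of_pow_eq_one ?_)).resolve_left fun h1 => ?_
  · rw [D.pow_eq_one ht, h.2]
  · exact h.1 (by simp [orderOf_eq_one_iff.1 h1])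

lemma isUnit_add (hn : n = q * r) (hq : q.Prime) (hr : r.Prime) {x y : ZMod n}
    (hx : (r : ZMod n) * x ≠ 0) (hx' : (q : ZMod n) * x = 0)
    (hy : (q : ZMod n) * y ≠ 0) (hy' : (r : ZMod n) * y = 0) : IsUnit (x + y) :=
  ZMod.isUnit_of_mul_ne_zero hn hq hr (by simpa [mul_add, hx'] using hy)
    (by simpa [mul_add, hy'] using hx)

lemma natCast_mod_mul {n k m : ℕ} {x : ZMod n} (h : (k : ZMod n) * x = 0) :
    ((m % k : ℕ) : ZMod n) * x = m * x := by
  have h1 := congrArg (Nat.cast (R := ZMod n)) (Nat.div_add_mod m k)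
  push_cast at h1
  linear_combination x * h1 - ((m / k : ℕ) : ZMod n) * h

lemma hasTour_ker_of_pair [Finite G] (hn : n = q * r) (hq : q.Prime)
    (hr : r.Prime) {S : Set G}
    (hS : ∀ z ∈ S, z⁻¹ ∈ S) {t u : G} (ht : t ∈ S) (hu : u ∈ S) (ht1 : D.α t = 1)
    (hu1 : D.α u = 1) (htν : D.IsPrimePart q r t)
    (huν : D.IsPrimePart r q u) :
    HasTour {z ∈ S | D.α z = 1} D.α.ker t := by
  have : NeZero n := ⟨hn ▸ mul_ne_zero hq.ne_zero hr.ne_zero⟩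
  have hord := htν.orderOf_eq hq ht1
  have h0 : HasTour {t} (Subgroup.zpowers t) t := hasTour_zpowers rfl (hord ▸ hq.two_le)
  have hχt := D.χ_eq_one t ht1
  have hχu := D.χ_eq_one u hu1
  obtain ⟨e, he⟩ := (isUnit_add hn hq hr htν.1 htν.2 huν.1 huν.2).exists_left_inv
  refine h0.extend (S := {z ∈ S | D.α z = 1}) (u := u) (k := r) ?_ ?_ ⟨hu, hu1⟩ ?_
    hr.one_lt.le ?_ ?_
  · exact fun z hz => ⟨hS z hz.1, by simp [hz.2]⟩
  · rintro _ rfl; exact ⟨ht, ht1⟩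
  · rintro _ rfl
    exact D.ext (by simp [mul_comm]) (by simp only [ν_mul, hχt, hχu]; ring)
  · rw [D.card_ker, Nat.card_zpowers, hord, hn, mul_comm]
  · intro g hg
    -- Since `e` inverts `ν t + ν u`, the exponent `ν g * e` serves for both `t` and `u`; for `u` it
    -- may be reduced modulo its order `r`.
    refine ⟨(D.ν g * e).val % r, Nat.mod_lt _ hr.pos, t ^ (D.ν g * e).val,
      Subgroup.npow_mem_zpowers t _, D.ext ?_ ?_⟩
    · rw [MonoidHom.mem_ker.1 hg]; simp [ht1, hu1]
    · rw [ν_mul, D.ν_pow_of_χ_eq_one hχt, D.ν_pow_of_χ_eq_one hχu, map_pow, hχu,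
        natCast_mod_mul huν.2, ZMod.natCast_zmod_val]
      linear_combination -D.ν g * he

/-- The word built from `s` and `u` has product of order `r`; interleaving it with `t`, of order
`q`, supplies the missing factor of the kernel. -/
lemma exists_tour_of_ker_of_not_ker [Finite G] (hp : (Nat.card Q).Prime) (hn : n = q * r)
    (hq : q.Prime) (hr : r.Prime) {S : Set G}
    (hS : ∀ z ∈ S, z⁻¹ ∈ S) {s t u : G} (hs : s ∈ S) (ht : t ∈ S) (hu : u ∈ S)
    (hs1 : D.α s ≠ 1) (hs0 : D.ν s = 0) (ht1 : D.α t = 1)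
    (hu1 : D.α u ≠ 1) (htν : D.IsPrimePart q r t)
    (huν : D.IsPrimePart r q u) :
    ∃ L, (∀ z ∈ L, z ∈ S) ∧ IsTour (⊤ : Subgroup G) L := by
  have : NeZero n := ⟨hn ▸ mul_ne_zero hq.ne_zero hr.ne_zero⟩
  obtain ⟨L, hLS, hL, c, hc, hLν⟩ := D.exists_word_of_prime hp hS hs hu hs1 hu1 hs0
  have hLα : D.α L.prod = 1 := by rw [map_list_prod]; exact hL.prod_eq
  have h1 : (q : ZMod n) * D.ν L.prod ≠ 0 := by
    rw [hLν, mul_left_comm]; exact fun h => huν.1 (hc.mul_right_eq_zero.1 h)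
  have h2 : (r : ZMod n) * D.ν L.prod = 0 := by
    rw [hLν, mul_left_comm, huν.2, mul_zero]
  obtain ⟨e, he⟩ := (isUnit_add hn hq hr htν.1 htν.2 h1 h2).exists_left_inv
  have hord : orderOf L.prod = r := by
    refine (hr.eq_one_or_self_of_dvd _ (orderOf_dvd_of_pow_eq_one ?_)).resolve_left fun h => ?_
    · rw [D.pow_eq_one hLα, h2]
    · exact h1 (by simp [orderOf_eq_one_iff.1 h])
  have hq1 : q - 1 + 1 = q := Nat.sub_add_cancel hq.one_lt.le
  refine D.exists_tour_interleave (k := q - 1) hLS ht hL ht1 ?_ ?_ fun y => ⟨y * e, y * e, ?_⟩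
  · rw [hq1, htν.2]
  · rw [hq1, hord, hn, mul_comm]
  · linear_combination -y * he

/-- The elements with `c * ν g = 0` form a subgroup, proper because `ν` is surjective. -/
lemma exists_mem_mul_ν_ne_zero [Finite G] [NeZero n] {S : Set G} (hgen : Subgroup.closure S = ⊤)
    {c : ZMod n} (hc : c ≠ 0) : ∃ t ∈ S, c * D.ν t ≠ 0 := by
  by_contra! h
  obtain ⟨g, -, hg⟩ := D.exists_eq 1 1
  have : c * D.ν g = 0 := by
    have hg' : g ∈ Subgroup.closure S := by rw [hgen]; trivial
    refine Subgroup.closure_induction (p := fun g _ => c * D.ν g = 0) h (by simp)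
      (fun x y _ _ hx hy => ?_) (fun x _ hx => ?_) hg'
    · rw [ν_mul]; linear_combination hx + D.χ x * hy
    · rw [ν_inv]; linear_combination -D.χ x⁻¹ * hx
  exact hc (by simpa [hg] using this)

lemma exists_mem_α_ne_one [Nontrivial Q] {S : Set G} (hgen : Subgroup.closure S = ⊤) :
    ∃ s ∈ S, D.α s ≠ 1 := by
  by_contra! h
  obtain ⟨x, hx⟩ := exists_ne (1 : Q)
  obtain ⟨g, rfl⟩ := D.surjective x
  have : g ∈ Subgroup.closure S := by rw [hgen]; trivial
  exact hx ((Subgroup.closure_le D.α.ker).2 h this)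

lemma exists_tour_of_ν_eq_zero [Finite G] (hn : n = q * r) (hp : (Nat.card Q).Prime)
    (hq : q.Prime) (hr : r.Prime) {S : Set G} (hS : ∀ z ∈ S, z⁻¹ ∈ S)
    (hgen : Subgroup.closure S = ⊤) {s : G} (hs : s ∈ S) (hs1 : D.α s ≠ 1) (hs0 : D.ν s = 0) :
    ∃ L, (∀ z ∈ L, z ∈ S) ∧ IsTour (⊤ : Subgroup G) L := by
  have : NeZero n := ⟨hn ▸ mul_ne_zero hq.ne_zero hr.ne_zero⟩
  have hnot {k l : ℕ} (hkl : n = k * l) (hk : k.Prime) (hl : l.Prime) : (k : ZMod n) ≠ 0 := by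
    rw [Ne, ZMod.natCast_eq_zero_iff, hkl]
    intro h
    have := Nat.le_of_dvd hk.pos h
    have := hl.two_le
    nlinarith [hk.pos]
  by_cases hx : ∃ x ∈ S, IsUnit (D.ν x)
  · obtain ⟨x, hx, hu⟩ := hx
    by_cases hx1 : D.α x = 1
    · exact D.exists_tour_of_ker hp hs hs1 (D.hasTour_ker_of_isUnit hx hx1 hu
        (by rw [hn]; nlinarith [hq.two_le, hr.two_le]))
    · obtain ⟨L, hLS, hL, e, he, hLν⟩ := D.exists_word_of_prime hp hS hs hx hs1 hx1 hs0
      exact D.exists_tour_of_isUnit hLS hL (hLν ▸ he.mul hu)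
  push Not at hx
  obtain ⟨t, ht, htr⟩ := D.exists_mem_mul_ν_ne_zero hgen (hnot (hn.trans (mul_comm q r)) hr hq)
  obtain ⟨u, hu, huq⟩ := D.exists_mem_mul_ν_ne_zero hgen (hnot hn hq hr)
  have htν : D.IsPrimePart q r t :=
    ⟨htr, by_contra fun h => hx t ht (ZMod.isUnit_of_mul_ne_zero hn hq hr h htr)⟩
  have huν : D.IsPrimePart r q u :=
    ⟨huq, by_contra fun h => hx u hu (ZMod.isUnit_of_mul_ne_zero hn hq hr huq h)⟩
  by_cases ht1 : D.α t = 1 <;> by_cases hu1 : D.α u = 1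
  · exact D.exists_tour_of_ker hp hs hs1
      (D.hasTour_ker_of_pair hn hq hr hS ht hu ht1 hu1 htν huν)
  · exact D.exists_tour_of_ker_of_not_ker hp hn hq hr hS hs ht hu hs1 hs0 ht1 hu1 htν huν
  · exact D.exists_tour_of_ker_of_not_ker hp (hn.trans (mul_comm q r)) hr hq hS hs hu ht hs1 hs0
      hu1 ht1 huν htν
  · obtain ⟨c, hc⟩ := (D.isUnit_χ_sub_one_of_prime hp ht1).exists_right_inv
    have hu' := D.isUnit_χ_sub_one_of_prime hp hu1
    -- With the origin moved so that `ν t = 0`, the new `ν u` keeps its nonzero value modulo `r` and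
    -- acquires `-(χ u - 1) * c * ν t`, nonzero, modulo `q`; it is therefore a unit.
    let E := D.gauge (-(c * D.ν t))
    have htE : E.ν t = 0 := by
      simp only [E, gauge_ν]; linear_combination -D.ν t * hc
    have huE : IsUnit (E.ν u) := by
      refine ZMod.isUnit_of_mul_ne_zero hn hq hr (fun h => huq ?_) fun h => htr ?_
      · simp only [E, gauge_ν] at h
        linear_combination h + (D.χ u - 1) * c * htν.2
      · simp only [E, gauge_ν] at h
        have h2 : (D.χ u - 1) * (c * (r * D.ν t)) = 0 := by
          linear_combination huν.2 - h
        have h3 := hu'.mul_right_eq_zero.1 h2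
        linear_combination (D.χ t - 1) * h3 - (r : ZMod n) * D.ν t * hc
    obtain ⟨L, hLS, hL, e, he, hLν⟩ := E.exists_word_of_prime hp hS ht hu ht1 hu1 htE
    exact E.exists_tour_of_isUnit hLS hL (hLν ▸ he.mul huE)

lemma exists_gauge {s : G} (hs : IsUnit (D.χ s - 1)) : ∃ w, (D.gauge w).ν s = 0 := by
  obtain ⟨c, hc⟩ := hs.exists_right_inv
  exact ⟨-(c * D.ν s), by simp only [gauge_ν]; linear_combination -D.ν s * hc⟩

/-- The case in which the commutator subgroup has prime index and its order is a product of two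
primes. -/
theorem exists_tour_of_prime_card [Finite G] (D : AffineCoord G Q n) (hn : n = q * r)
    (hp : (Nat.card Q).Prime) (hq : q.Prime) (hr : r.Prime) {S : Set G} (hS : ∀ z ∈ S, z⁻¹ ∈ S)
    (hgen : Subgroup.closure S = ⊤) :
    ∃ L, (∀ z ∈ L, z ∈ S) ∧ IsTour (⊤ : Subgroup G) L := by
  have : Finite Q := Finite.of_surjective _ D.surjective
  have : Nontrivial Q := (Finite.one_lt_card_iff_nontrivial).1 hp.one_lt
  obtain ⟨s, hs, hs1⟩ := D.exists_mem_α_ne_one hgen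
  obtain ⟨w, hw⟩ := D.exists_gauge (D.isUnit_χ_sub_one_of_prime hp hs1)
  exact (D.gauge w).exists_tour_of_ν_eq_zero hn hp hq hr hS hgen hs hs1 hw

end TwoPrimes

end AffineCoord

/-! ### Commutator subgroup of prime order -/

lemma exists_coset_of_prime_index {G : Type*} [Group G] [Finite G] (H : Subgroup G) [H.Normal]
    {u : G} (hu : u ∉ H) {k : ℕ} (hk : k.Prime) (hcard : Nat.card G = k * Nat.card H) (g : G) :
    ∃ i < k, ∃ g' ∈ H, g = u ^ i * g' := by
  obtain ⟨K, -, -, k', hk', hK, hcov⟩ := exists_coset_decomposition H hu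
  have h1 := K.card_subgroup_dvd_card
  rw [hcard, hK] at h1
  have h2 := (hk.eq_one_or_self_of_dvd _
    (Nat.dvd_of_mul_dvd_mul_right Nat.card_pos h1)).resolve_left (by omega)
  rw [h2] at hcov hK
  have : K = ⊤ := Subgroup.eq_top_of_card_eq _ (by rw [hK, hcard])
  exact hcov g (by rw [this]; trivial)

lemma zigzag_prod {G : Type*} [Group G] (M : List G) (u : G) :
    (zigzag M u).prod = M.prod * (u * (M.prod⁻¹ * u)) := by
  simp [zigzag, ← List.prod_inv_reverse]

lemma extendOdd_prod {G : Type*} [Group G] (x : G) (M : List G) (y u : G) (h : ℕ) :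
    (extendOdd x M y u h).prod =
      x * ((zigzag M u).prod ^ h * (M.prod * (y * u⁻¹ ^ (2 * h)))) := by
  simp only [extendOdd, List.prod_append, List.prod_cons, List.prod_flatten, List.map_replicate,
    List.prod_replicate]

lemma extendEven_prod {G : Type*} [Group G] (x : G) (M : List G) (u : G) (h : ℕ) :
    (extendEven x M u h).prod = x * ((zigzag M u).prod ^ h *
      (M.prod * (u * (M.prod⁻¹ * (x⁻¹ * u⁻¹ ^ (2 * h + 1)))))) := by
  simp only [extendEven, List.prod_append, List.prod_cons, List.prod_flatten, List.map_replicate,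
    List.prod_replicate, List.prod_inv_reverse]

lemma map_zigzag {G Q : Type*} [Group G] [Group Q] (f : G →* Q) (M : List G) (u : G) :
    (zigzag M u).map f = zigzag (M.map f) (f u) := by
  simp [zigzag, List.map_reverse, Function.comp_def]

lemma map_extendOdd {G Q : Type*} [Group G] [Group Q] (f : G →* Q) (x : G) (M : List G)
    (y u : G) (h : ℕ) :
    (extendOdd x M y u h).map f = extendOdd (f x) (M.map f) (f y) (f u) h := by
  simp [extendOdd, List.map_flatten, map_zigzag]

lemma map_extendEven {G Q : Type*} [Group G] [Group Q] (f : G →* Q) (x : G) (M : List G)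
    (u : G) (h : ℕ) :
    (extendEven x M u h).map f = extendEven (f x) (M.map f) (f u) h := by
  simp [extendEven, List.map_flatten, map_zigzag, List.map_reverse, Function.comp_def]

namespace AffineCoord

variable {G Q : Type*} [Group G] [CommGroup Q] {r : ℕ} [Fact r.Prime] (D : AffineCoord G Q r)

lemma χ_inv (g : G) : D.χ g⁻¹ = (D.χ g)⁻¹ := eq_inv_of_mul_eq_one_right (D.χ_mul_inv g)

lemma χ_ne_zero (g : G) : D.χ g ≠ 0 := (D.isUnit_χ g).ne_zero

lemma commute_of_ν_eq_zero {s t : G} (hs : D.ν s = 0) (ht : D.ν t = 0) : Commute s t :=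
  D.ext (by simp [mul_comm]) (by rw [ν_mul, ν_mul, hs, ht]; simp)

/-- If a tour of `Q` lifts to a word with nontrivial product, that product generates the kernel.
Otherwise interleaving with `t ^ (r - 1)` keeps the product `1`, and the runs of `t` already cover
the kernel. -/
lemma exists_tour_of_mem_ker [Finite G] {S : Set G} (hS : ∀ z ∈ S, z⁻¹ ∈ S)
    (hgen : Subgroup.closure S = ⊤) [Nontrivial Q] {t : G} (ht : t ∈ S) (ht1 : D.α t = 1)
    (htne : t ≠ 1) : ∃ L, (∀ z ∈ L, z ∈ S) ∧ IsTour (⊤ : Subgroup G) L := by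
  have : Finite Q := Finite.of_surjective _ D.surjective
  have hr : r.Prime := Fact.out
  obtain ⟨s, hs, hs1⟩ := D.exists_mem_α_ne_one hgen
  obtain ⟨L, hLS, hL⟩ := exists_tour_map D.α D.surjective hS hgen hs hs1
  have hα : D.α (s :: L).prod = 1 := by rw [map_list_prod]; exact hL.prod_eq
  by_cases hν : D.ν (s :: L).prod = 0
  · have htν : D.ν t ≠ 0 := fun h => htne (D.eq_one _ ht1 h)
    have h1 : (s :: L).prod = 1 := D.eq_one _ hα hν
    have hr1 : r - 1 + 1 = r := Nat.sub_add_cancel hr.one_lt.le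
    refine D.exists_tour_interleave (k := r - 1) hLS ht hL ht1 ?_ ?_ fun y =>
      ⟨0, y * (D.ν t)⁻¹, ?_⟩
    · rw [hr1]; simp
    · rw [h1, orderOf_one, hr1, one_mul]
    · field_simp; simp
  · exact D.exists_tour_of_isUnit hLS hL (isUnit_iff_ne_zero.2 hν)

/-- Exchanging the first letter `s` for `t` alters `ν` of the product by `ν t - ν s ≠ 0`, so one of
the two words has nontrivial product. -/
lemma exists_tour_of_α_eq [Finite G] {S : Set G} (hS : ∀ z ∈ S, z⁻¹ ∈ S)
    (hgen : Subgroup.closure S = ⊤) {s t : G} (hs : s ∈ S) (ht : t ∈ S) (hs1 : D.α s ≠ 1)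
    (hst : D.α s = D.α t) (hne : s ≠ t) :
    ∃ L, (∀ z ∈ L, z ∈ S) ∧ IsTour (⊤ : Subgroup G) L := by
  have : Finite Q := Finite.of_surjective _ D.surjective
  obtain ⟨L, hLS, hL⟩ := exists_tour_map D.α D.surjective hS hgen hs hs1
  by_cases hν : D.ν (s :: L).prod = 0
  · refine D.exists_tour_of_isUnit (L := t :: L) (S := S) ?_ ?_ (isUnit_iff_ne_zero.2 fun h => ?_)
    · intro z hz
      rcases List.mem_cons.1 hz with rfl | hz
      exacts [ht, hLS z (by simp [hz])]
    · simpa [hst] using hL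
    · rw [List.prod_cons, ν_mul] at hν h
      refine hne (D.ext hst ?_)
      rw [D.χ_congr hst] at hν
      linear_combination hν - h
  · exact D.exists_tour_of_isUnit hLS hL (isUnit_iff_ne_zero.2 hν)

/-- A tour built from a central subgroup of order `q` instead of the kernel of `α`. -/
lemma exists_tour_of_central [Finite G] {p q : ℕ} (hq : q.Prime) (hcard : Nat.card Q = p * q)
    {S : Set G} {t : G} {A : List G} (ht : t ∈ S) (hA : ∀ z ∈ A, z ∈ S) (hlen : A.length = p)
    (hord : orderOf (D.α t) = q) (htχ : D.χ t = 1) (htν : D.ν t ≠ 0)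
    (hν : D.ν (interleave t (r - 1) A).prod = 0)
    (hα : D.α A.prod = 1) (hα1 : ¬ q ∣ (r - 1) * p)
    (hcov : ∀ g, ∃ v ∈ visits 1 A, (D.α v)⁻¹ * D.α g ∈ Subgroup.zpowers (D.α t)) :
    ∃ L, (∀ z ∈ L, z ∈ S) ∧ IsTour (⊤ : Subgroup G) L := by
  have : Finite Q := Finite.of_surjective _ D.surjective
  have hr : r.Prime := Fact.out
  have hr1 : r - 1 + 1 = r := Nat.sub_add_cancel hr.one_lt.le
  let W := interleave t (r - 1) A
  have hzα : D.α W.prod = D.α t ^ ((r - 1) * p) := by rw [α_interleave, hα, one_mul, hlen]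
  have hzα1 : D.α W.prod ≠ 1 := by
    rw [hzα, Ne, ← orderOf_dvd_iff_pow_eq_one, hord]; exact hα1
  have hzαq : D.α W.prod ^ q = 1 := by
    rw [hzα, ← pow_mul, mul_comm, pow_mul, ← hord, pow_orderOf_eq_one, one_pow]
  have hzχ : D.χ W.prod = 1 := by
    rw [D.χ_congr (h := t ^ ((r - 1) * p)) (by rw [hzα, map_pow]), map_pow, htχ, one_pow]
  have hzord : orderOf (D.α W.prod) = q :=
    (hq.eq_one_or_self_of_dvd _ (orderOf_dvd_of_pow_eq_one hzαq)).resolve_left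
      (by rwa [orderOf_eq_one_iff])
  -- The product has `ν = 0` and `χ = 1`, hence is central; this lets its powers be moved past `u`.
  have hzcomm (g : G) : W.prod * g = g * W.prod :=
    D.ext (by simp [mul_comm]) (by rw [ν_mul, ν_mul, hν, hzχ]; simp)
  have hzord' : orderOf W.prod = q := by
    refine dvd_antisymm (orderOf_dvd_of_pow_eq_one ?_) (hzord ▸ orderOf_map_dvd D.α _)
    exact D.eq_one _ (by rw [map_pow, hzαq]) (D.ν_pow_of_eq_zero hν q)
  have hzz : Subgroup.zpowers (D.α W.prod) = Subgroup.zpowers (D.α t) := by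
    refine Subgroup.eq_of_le_of_card_ge ?_ (by rw [Nat.card_zpowers, Nat.card_zpowers, hord, hzord])
    rw [Subgroup.zpowers_le, hzα]
    exact Subgroup.npow_mem_zpowers _ _
  refine ⟨_, fun z hz => ?_, IsTour.of_powers (L := W) ?_ fun g _ => ?_⟩
  · simp only [List.mem_flatten, List.mem_replicate] at hz
    obtain ⟨l, ⟨_, rfl⟩, h⟩ := hz
    exact mem_interleave _ hA ht z h
  · rw [hzord', length_interleave, hlen, hr1, Subgroup.card_top, D.card_eq, hcard]; ring
  · obtain ⟨v, hv, hvg⟩ := hcov g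
    obtain ⟨u, m, hu, hmem⟩ := D.mem_visits_interleave (t := t) (k := r - 1) hv
    -- Along a run of `t` the `ν`-coordinate takes every value, so `j` settles `ν`; the remaining
    -- discrepancy lies in the powers of `α t`, which are those of the product of `W`.
    obtain ⟨j, hjr, hj⟩ : ∃ j < r, D.ν (t ^ j) = D.ν (u⁻¹ * g) := by
      refine ⟨(D.ν (u⁻¹ * g) * (D.ν t)⁻¹).val, ZMod.val_lt _, ?_⟩
      rw [D.ν_pow_of_χ_eq_one htχ, ZMod.natCast_zmod_val]; field_simp
    have hmem1 : D.α (u⁻¹ * g * (t ^ j)⁻¹) ∈ Subgroup.zpowers (D.α W.prod) := by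
      have h1 : D.α (u⁻¹ * g * (t ^ j)⁻¹) =
          ((D.α v)⁻¹ * D.α g) * ((D.α t ^ m)⁻¹ * (D.α t ^ j)⁻¹) := by
        simp only [map_mul, map_inv, map_pow, hu, mul_inv]
        rw [mul_right_comm (D.α v)⁻¹ ((D.α t ^ m)⁻¹) (D.α g), mul_assoc]
      rw [hzz, h1]
      exact mul_mem hvg (mul_mem (inv_mem (Subgroup.npow_mem_zpowers _ _))
        (inv_mem (Subgroup.npow_mem_zpowers _ _)))
    obtain ⟨i, -, hi⟩ := exists_pow_of_mem_zpowers (by rw [hzord]; exact hq.pos) hmem1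
    have hχ : D.χ (u⁻¹ * g) = 1 := by
      have h2 : D.α (u⁻¹ * g) = D.α (W.prod ^ i * t ^ j) := by
        rw [map_mul D.α (W.prod ^ i), map_pow, ← hi]; simp
      rw [D.χ_congr h2, map_mul, map_pow, map_pow, hzχ, htχ]; simp
    have h3 : u⁻¹ * g = W.prod ^ i * t ^ j := by
      refine D.ext ?_ ?_
      · rw [map_mul D.α (W.prod ^ i), map_pow, ← hi]; simp
      · rw [D.ν_mul (W.prod ^ i), D.ν_pow_of_eq_zero hν, map_pow, hzχ, hj]; simp
    refine ⟨i, u * t ^ j, hmem j (by omega), ?_⟩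
    have h4 : Commute (W.prod ^ i) u := Commute.pow_left (hzcomm u) i
    rw [← mul_assoc, h4.eq, mul_assoc, ← h3, mul_inv_cancel_left]

end AffineCoord

namespace AffineCoord

variable {G Q : Type*} [Group G] [CommGroup Q] {r : ℕ} [Fact r.Prime] (D : AffineCoord G Q r)

lemma eq_one_of_pow {M : Type*} [Monoid M] {x : M} {p q : ℕ} (hpq : p.Coprime q)
    (h1 : x ^ p = 1) (h2 : x ^ q = 1) : x = 1 := by
  have := Nat.dvd_gcd (orderOf_dvd_of_pow_eq_one h1) (orderOf_dvd_of_pow_eq_one h2)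
  rw [hpq] at this
  exact orderOf_eq_one_iff.1 (Nat.dvd_one.1 this)

lemma α_notMem_zpowers {p q : ℕ} (hp : p.Prime) (hpq : p.Coprime q) {s t : Q}
    (hs : orderOf s = p) (ht : orderOf t = q) : s ∉ Subgroup.zpowers t := by
  intro h
  have h1 := orderOf_dvd_of_mem_zpowers h
  rw [hs, ht] at h1
  exact hp.one_lt.ne' (Nat.eq_one_of_dvd_coprimes hpq dvd_rfl h1)

lemma χ_pow_eq_one {s : G} {p : ℕ} (hs : orderOf (D.α s) = p) : D.χ s ^ p = 1 := by
  rw [← map_pow]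
  exact D.χ_eq_one _ (by rw [map_pow, ← hs, pow_orderOf_eq_one])

lemma natCast_sub_one_ne_zero {q : ℕ} (hq : 1 ≤ q) (h : ¬ r ∣ q - 1) : (q : ZMod r) - 1 ≠ 0 := by
  rwa [← Nat.cast_one, ← Nat.cast_sub hq, Ne, ZMod.natCast_eq_zero_iff]

lemma isTour_extend [Finite Q] {p q : ℕ} (hp : p.Prime) (hpq : p.Coprime q)
    (hcard : Nat.card Q = p * q) {s t : Q} {k : ℕ} (hs : s ∉ Subgroup.zpowers t)
    (ht : orderOf t = q) (hk : orderOf t = k + 2) :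
    (∀ h, p = 2 * h + 1 → IsTour ⊤ (extendOdd t (List.replicate k t) t s h)) ∧
    (∀ h, p = 2 * h + 2 → IsTour ⊤ (extendEven t (List.replicate k t) s h)) := by
  have hz : Nat.card Q = p * Nat.card (Subgroup.zpowers t) := by rw [Nat.card_zpowers, ht, hcard]
  constructor
  · rintro h rfl
    exact (IsTour.zpowers hk).extendOdd (fun z _ => Commute.all s z)
      (by rw [Subgroup.card_top, hz]) fun g _ => exists_coset_of_prime_index _ hs hp hz g
  · rintro h rfl
    exact (IsTour.zpowers hk).extendEven (fun z _ => Commute.all s z)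
      (by rw [Subgroup.card_top, hz]) fun g _ => exists_coset_of_prime_index _ hs hp hz g

/-- The two generators have coprime prime orders modulo the kernel and neither centralizes it. -/
lemma exists_tour_of_coprime_orders_of_ne [Finite G] {p q : ℕ} (hp : p.Prime) (hq : q.Prime)
    (hpq : p.Coprime q) (hp2 : p ≠ 2) (hcard : Nat.card Q = p * q) {S : Set G}
    (hS : ∀ z ∈ S, z⁻¹ ∈ S) {s t : G} (hs : s ∈ S) (ht : t ∈ S) (hsp : orderOf (D.α s) = p)
    (htq : orderOf (D.α t) = q) (hsχ : D.χ s ≠ 1) (htχ : D.χ t ≠ 1) (hsν : D.ν s = 0)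
    (htν : D.ν t ≠ 0) : ∃ L, (∀ z ∈ L, z ∈ S) ∧ IsTour (⊤ : Subgroup G) L := by
  have : Finite Q := Finite.of_surjective _ D.surjective
  obtain ⟨h, hh⟩ := hp.odd_of_ne_two hp2
  obtain ⟨k, hk⟩ : ∃ k, q = k + 2 := ⟨q - 2, by have := hq.two_le; omega⟩
  have hM : ∀ z ∈ t :: (List.replicate k t ++ [t]), z ∈ S := by
    intro z hz
    simp only [List.mem_cons, List.mem_append, List.mem_replicate, List.not_mem_nil,
      or_false] at hz
    rcases hz with rfl | ⟨_, rfl⟩ | rfl <;> exact ht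
  have htour := (isTour_extend hp hpq hcard (α_notMem_zpowers hp hpq hsp htq) htq
    (htq.trans hk)).1 h hh
  refine D.exists_tour_of_isUnit (L := extendOdd t (List.replicate k t) t s h)
    (mem_extendOdd hS hM hs) (by simpa [map_extendOdd] using htour) (isUnit_iff_ne_zero.2 ?_)
  intro h0
  set b := D.χ s with hb
  set c := D.χ t with hc
  have hbp : b ^ p = 1 := D.χ_pow_eq_one hsp
  have hcq : c ^ q = 1 := D.χ_pow_eq_one htq
  have hb0 : b ≠ 0 := D.χ_ne_zero s
  have hc0 : c ≠ 0 := D.χ_ne_zero t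
  have hc1 : c - 1 ≠ 0 := sub_ne_zero.2 htχ
  have hb1 : b - 1 ≠ 0 := sub_ne_zero.2 hsχ
  -- In terms of the scaled variable `w`, powers of `t` have the simple coordinate `(c ^ k - 1) *
  -- w`.
  obtain ⟨w, hw⟩ : ∃ w, D.ν t = (c - 1) * w := ⟨D.ν t / (c - 1), by field_simp⟩
  have hw0 : w ≠ 0 := by rintro rfl; exact htν (by rw [hw, mul_zero])
  have hCw : D.ν (t ^ k) = (c ^ k - 1) * w := by
    have := D.mul_ν_pow t k
    rw [← hc, hw] at this
    exact mul_left_cancel₀ hc1 (by linear_combination this)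
  have hCc : c ^ k * c ^ 2 = 1 := by rw [← pow_add, ← hk, hcq]
  have hBb : b ^ (2 * h) * b = 1 := by rw [← pow_succ, ← hh, hbp]
  set C := c ^ k with hC
  have hC0 : C ≠ 0 := pow_ne_zero _ hc0
  have hZν : D.ν (zigzag (List.replicate k t) s).prod = (C - 1) * w * (1 - b) := by
    simp only [zigzag_prod, List.prod_replicate, ν_mul, map_pow, hsν, hCw, ν_inv, χ_inv,
      ← hb, ← hc, ← hC]
    field_simp
    ring
  have hZχ : D.χ (zigzag (List.replicate k t) s).prod = b ^ 2 := by
    simp only [zigzag_prod, List.prod_replicate, map_mul, map_pow, χ_inv, ← hb, ← hc, ← hC]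
    field_simp
  have hX := D.mul_ν_pow (zigzag (List.replicate k t) s).prod h
  rw [hZχ, hZν, ← pow_mul] at hX
  simp only [extendOdd_prod, List.prod_replicate, ν_mul, map_pow, hZχ, hw, hCw,
    D.ν_pow_of_eq_zero (D.ν_inv_of_eq_zero hsν), ← hc, ← hC, ← pow_mul] at h0
  set X := D.ν ((zigzag (List.replicate k t) s).prod ^ h)
  set B := b ^ (2 * h)
  -- The relations `c ^ k * c ^ 2 = 1` and `b ^ (2 * h) * b = 1` eliminate the powers. What is left
  -- forces `c * b = 1`, so `c` has order dividing both `p` and `q`.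
  have key : w * (b - 1) ^ 2 * (c - 1) * (c * b - 1) = 0 := by
    linear_combination b * c * (b ^ 2 - 1) * h0 - b * c ^ 2 * hX
      - (c ^ 2 * (b ^ 2 - 1) * (C * c - 1) * w + c ^ 2 * (C - 1) * w * (1 - b)) * hBb
      - (c * (b ^ 2 - 1) * w + (1 - b) ^ 2 * w) * hCc
  have hcb : c * b - 1 = 0 := by
    simpa [hw0, hb1, hc1] using key
  have h2 : c ^ p = 1 := by
    have : (c * b) ^ p = 1 := by rw [sub_eq_zero.1 hcb, one_pow]
    rwa [mul_pow, hbp, mul_one] at this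
  exact htχ (eq_one_of_pow hpq h2 hcq)

end AffineCoord

lemma prod_interleave_replicate {G : Type*} [Group G] (s t : G) (k p : ℕ) :
    (interleave t k (List.replicate p s)).prod = (t ^ k * s) ^ p := by
  induction p with
  | zero => simp [interleave]
  | succ p ih =>
    have : interleave t k (List.replicate (p + 1) s) =
        List.replicate k t ++ s :: interleave t k (List.replicate p s) := by
      simp [interleave, List.replicate_succ]
    rw [this, List.prod_append, List.prod_cons, ih, List.prod_replicate, ← mul_assoc, ← pow_succ']

namespace AffineCoord

variable {G Q : Type*} [Group G] [CommGroup Q] {r : ℕ} [Fact r.Prime] (D : AffineCoord G Q r)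

/-- The two generators have coprime prime orders modulo the kernel and one of them centralizes
it. -/
lemma exists_tour_of_coprime_orders_of_eq [Finite G] {p q : ℕ} (hp : p.Prime) (hq : q.Prime)
    (hpq : p.Coprime q) (hcard : Nat.card Q = p * q) {S : Set G}
    (hS : ∀ z ∈ S, z⁻¹ ∈ S) {s t : G} (hs : s ∈ S) (ht : t ∈ S) (hsp : orderOf (D.α s) = p)
    (htq : orderOf (D.α t) = q) (hsχ : D.χ s ≠ 1) (htχ : D.χ t = 1) (hsν : D.ν s = 0)
    (htν : D.ν t ≠ 0) : ∃ L, (∀ z ∈ L, z ∈ S) ∧ IsTour (⊤ : Subgroup G) L := by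
  have : Finite Q := Finite.of_surjective _ D.surjective
  have hr : r.Prime := Fact.out
  have hbp : D.χ s ^ p = 1 := D.χ_pow_eq_one hsp
  have hb1 : D.χ s - 1 ≠ 0 := sub_ne_zero.2 hsχ
  have hz : Nat.card Q = p * Nat.card (Subgroup.zpowers (D.α t)) := by
    rw [Nat.card_zpowers, htq, hcard]
  -- If `q ∣ r - 1`, then `r ∤ q - 1` by size, and a word extended from the powers of `s` has a
  -- product with nonzero `ν`. If not, the product of the interleaved word has order `q` modulo the
  -- kernel and is central.
  by_cases hqr : q ∣ r - 1
  · have hrq : ¬ r ∣ q - 1 := fun h => by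
      have h1 := Nat.le_of_dvd (by have := hr.two_le; omega) hqr
      have h2 := Nat.le_of_dvd (by have := hq.two_le; omega) h
      have := hr.two_le
      omega
    obtain ⟨k, hk⟩ : ∃ k, p = k + 2 := ⟨p - 2, by have := hp.two_le; omega⟩
    have hM : ∀ z ∈ s :: (List.replicate k s ++ [s]), z ∈ S := by
      intro z hz
      simp only [List.mem_cons, List.mem_append, List.mem_replicate, List.not_mem_nil,
        or_false] at hz
      rcases hz with rfl | ⟨_, rfl⟩ | rfl <;> exact hs
    obtain ⟨hodd, heven⟩ := isTour_extend hq hpq.symm (hcard.trans (mul_comm p q))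
      (α_notMem_zpowers hq hpq.symm htq hsp) hsp (hsp.trans hk)
    have htinv : D.χ t⁻¹ = 1 := by rw [χ_inv, htχ, inv_one]
    have htνinv : D.ν t⁻¹ = -D.ν t := by rw [ν_inv, htinv, one_mul]
    have hsk := D.ν_pow_of_eq_zero hsν k
    have hsk' := D.ν_inv_of_eq_zero hsk
    have hsνinv := D.ν_inv_of_eq_zero hsν
    have hb0 := D.χ_ne_zero s
    have hB : D.χ s ^ k * D.χ s ^ 2 = 1 := by rw [← pow_add, ← hk, hbp]
    rcases hq.eq_two_or_odd' with hq2 | ⟨h, hh⟩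
    · refine D.exists_tour_of_isUnit (L := extendEven s (List.replicate k s) t 0)
        (mem_extendEven hS hM ht) (by simpa [map_extendEven] using heven 0 hq2)
        (isUnit_iff_ne_zero.2 fun h0 => ?_)
      simp only [extendEven_prod, List.prod_replicate, pow_zero, one_mul, mul_zero, zero_add,
        pow_one, ν_mul, χ_inv, map_pow, hsν, hsk, hsk', hsνinv, htχ, htνinv] at h0
      field_simp at h0
      have : D.ν t * (D.χ s - 1) = 0 := by
        linear_combination -D.χ s * h0 + D.ν t * hB
      exact (mul_ne_zero htν hb1) this
    · refine D.exists_tour_of_isUnit (L := extendOdd s (List.replicate k s) s t h)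
        (mem_extendOdd hS hM ht) (by simpa [map_extendOdd] using hodd h hh)
        (isUnit_iff_ne_zero.2 fun h0 => ?_)
      have hZχ : D.χ (zigzag (List.replicate k s) t).prod = 1 := by
        simp only [zigzag_prod, List.prod_replicate, map_mul, map_pow, χ_inv, htχ]
        field_simp
      have hZν : D.ν (zigzag (List.replicate k s) t).prod = (D.χ s ^ k + 1) * D.ν t := by
        simp only [zigzag_prod, List.prod_replicate, ν_mul, map_pow, χ_inv, htχ, hsk, hsk']
        field_simp
        ring
      simp only [extendOdd_prod, List.prod_replicate, ν_mul, map_pow, hsν, hsk,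
        D.ν_pow_of_χ_eq_one hZχ, D.ν_pow_of_χ_eq_one htinv, htνinv, hZχ, hZν, one_pow] at h0
      -- Here `2 * h = q - 1`, which `r` does not divide.
      have h1 : (h : ZMod r) ≠ 0 := by
        rw [Ne, ZMod.natCast_eq_zero_iff]
        exact fun hd => hrq (by rw [hh, Nat.add_sub_cancel]; exact hd.mul_left 2)
      have key : (h : ZMod r) * D.ν t * (D.χ s - 1) ^ 2 = 0 := by
        push_cast at h0
        linear_combination D.χ s * h0 - (h * D.ν t - 2 * h * D.ν t * D.χ s) * hB
      simp [h1, htν, hb1] at key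
  · refine D.exists_tour_of_central hq hcard ht (A := List.replicate p s)
      (fun z hz => (List.mem_replicate.1 hz).2 ▸ hs) (by simp) htq htχ htν ?_ ?_ ?_ fun g => ?_
    · rw [prod_interleave_replicate]
      have h1 := D.mul_ν_pow (t ^ (r - 1) * s) p
      rw [map_mul, map_pow, htχ, one_pow, one_mul, hbp, sub_self, zero_mul] at h1
      exact (mul_eq_zero.1 h1).resolve_left hb1
    · rw [List.prod_replicate, map_pow, ← hsp, pow_orderOf_eq_one]
    · rw [hq.dvd_mul, not_or]
      exact ⟨hqr, fun h => hq.one_lt.ne' (Nat.eq_one_of_dvd_coprimes hpq h dvd_rfl)⟩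
    · obtain ⟨i, hi, g', hg', h⟩ := exists_coset_of_prime_index _
        (α_notMem_zpowers hp hpq hsp htq) hp hz (D.α g)
      refine ⟨s ^ i, by simpa using mem_visits_replicate 1 s hi, ?_⟩
      rw [h, map_pow, inv_mul_cancel_left]
      exact hg'

/-- Two noncommuting generators of coprime prime orders modulo the kernel. -/
lemma exists_tour_of_coprime_orders [Finite G] {p q : ℕ} (hp : p.Prime) (hq : q.Prime)
    (hpq : p.Coprime q) (hcard : Nat.card Q = p * q) {S : Set G}
    (hS : ∀ z ∈ S, z⁻¹ ∈ S) {s t : G} (hs : s ∈ S) (ht : t ∈ S) (hsp : orderOf (D.α s) = p)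
    (htq : orderOf (D.α t) = q) (hst : ¬ Commute s t) :
    ∃ L, (∀ z ∈ L, z ∈ S) ∧ IsTour (⊤ : Subgroup G) L := by
  have hcard' := hcard.trans (mul_comm p q)
  have hgauge {a : G} (ha : D.χ a ≠ 1) : ∃ w, (D.gauge w).ν a = 0 :=
    D.exists_gauge (isUnit_iff_ne_zero.2 (sub_ne_zero.2 ha))
  by_cases hsχ : D.χ s = 1
  · by_cases htχ : D.χ t = 1
    · exact absurd (D.ext (by simp [mul_comm]) (by rw [ν_mul, ν_mul, hsχ, htχ]; ring)) hst
    · obtain ⟨w, hw⟩ := hgauge htχ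
      exact (D.gauge w).exists_tour_of_coprime_orders_of_eq hq hp hpq.symm hcard' hS ht hs htq hsp
        htχ hsχ hw fun h => hst ((D.gauge w).commute_of_ν_eq_zero h hw)
  · obtain ⟨w, hw⟩ := hgauge hsχ
    have hν : (D.gauge w).ν t ≠ 0 := fun h => hst ((D.gauge w).commute_of_ν_eq_zero hw h)
    by_cases htχ : D.χ t = 1
    · exact (D.gauge w).exists_tour_of_coprime_orders_of_eq hp hq hpq hcard hS hs ht hsp htq
        hsχ htχ hw hν
    -- The word for this case needs an odd first order, so the generators are swapped when `p = 2`.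
    by_cases hp2 : p = 2
    · obtain ⟨w, hw⟩ := hgauge htχ
      exact (D.gauge w).exists_tour_of_coprime_orders_of_ne hq hp hpq.symm
        (by rintro rfl; rw [hp2] at hpq; norm_num at hpq) hcard' hS ht hs htq hsp
        htχ hsχ hw fun h => hst ((D.gauge w).commute_of_ν_eq_zero h hw)
    · exact (D.gauge w).exists_tour_of_coprime_orders_of_ne hp hq hpq hp2 hcard hS hs ht hsp htq
        hsχ htχ hw hν

end AffineCoord

namespace AffineCoord

variable {G Q : Type*} [Group G] [CommGroup Q] {r : ℕ} [Fact r.Prime] (D : AffineCoord G Q r)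

lemma orderOf_eq_mul {q : ℕ} (hqr : q.Coprime r) {z : G}
    (hzα : orderOf (D.α z) = q) (hzχ : D.χ z = 1) (hzν : D.ν z ≠ 0) : orderOf z = q * r := by
  have hzq : D.α (z ^ q) = 1 := by rw [map_pow, ← hzα, pow_orderOf_eq_one]
  have hν : D.ν (z ^ q) ≠ 0 := by
    rw [D.ν_pow_of_χ_eq_one hzχ]
    refine mul_ne_zero (fun h => ?_) hzν
    rw [ZMod.natCast_eq_zero_iff] at h
    exact (Fact.out : r.Prime).one_lt.ne' (Nat.eq_one_of_dvd_coprimes hqr h dvd_rfl)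
  refine dvd_antisymm (orderOf_dvd_of_pow_eq_one ?_) (hqr.mul_dvd_of_dvd_of_dvd ?_ ?_)
  · rw [pow_mul, D.pow_eq_one hzq]; simp
  · exact hzα ▸ orderOf_map_dvd D.α z
  · rw [← D.orderOf_eq hzq (isUnit_iff_ne_zero.2 hν)]
    exact orderOf_pow_dvd q

/-- The dihedral case: one generator inverts the kernel of `α` and generates modulo it. -/
lemma exists_tour_of_χ_eq_neg_one [Finite G] {q : ℕ} (hq : q.Prime) (hq2 : q ≠ 2)
    (hqr : q.Coprime r) (hcard : Nat.card Q = 2 * q) {S : Set G} (hS : ∀ z ∈ S, z⁻¹ ∈ S)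
    {s t : G} (hs : s ∈ S) (ht : t ∈ S) (hsα : orderOf (D.α s) = Nat.card Q)
    (ht1 : D.α t ≠ 1) (hst : D.α s * D.α t ≠ 1) (hsχ : D.χ s = -1) (hsχ1 : D.χ s ≠ 1)
    (hsν : D.ν s = 0) (htν : D.ν t ≠ 0) :
    ∃ L, (∀ z ∈ L, z ∈ S) ∧ IsTour (⊤ : Subgroup G) L := by
  have : Finite Q := Finite.of_surjective _ D.surjective
  have hr : r.Prime := Fact.out
  have hone : (-1 : ZMod r) ≠ 1 := hsχ ▸ hsχ1
  obtain ⟨i, hi, hti⟩ := exists_pow_of_mem_zpowers (orderOf_pos (D.α s))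
    (mem_zpowers_of_orderOf_eq hsα (D.α t))
  have htχ : D.χ t = (-1) ^ i := by
    rw [D.χ_congr (h := s ^ i) (by simpa using hti), map_pow, hsχ]
  have hord {j : ℕ} (hj : Even j) (h1 : D.α s ^ j ≠ 1) : orderOf (D.α s ^ j) = q := by
    refine (hq.eq_one_or_self_of_dvd _ (orderOf_dvd_of_pow_eq_one ?_)).resolve_left
      (by rwa [orderOf_eq_one_iff])
    obtain ⟨k, rfl⟩ := hj
    rw [← pow_mul, show (k + k) * q = 2 * q * k by ring, pow_mul, ← hcard, pow_card_eq_one',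
      one_pow]
  -- For even `i`, `t` centralizes the kernel and has order `q` modulo it. For odd `i`, `s * t`
  -- generates a cyclic subgroup of index 2, and alternating `s` and `t` is a tour.
  rcases Nat.even_or_odd i with hie | hio
  · rw [hie.neg_one_pow] at htχ
    have htq : orderOf (D.α t) = q := by rw [hti]; exact hord hie (hti ▸ ht1)
    have hz : Nat.card Q = 2 * Nat.card (Subgroup.zpowers (D.α t)) := by
      rw [Nat.card_zpowers, htq, hcard]
    have hsz : D.α s ∉ Subgroup.zpowers (D.α t) := by
      intro h
      have := Nat.le_of_dvd hq.pos (htq ▸ orderOf_dvd_of_mem_zpowers h)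
      rw [hsα, hcard] at this
      have := hq.pos
      omega
    have hsνinv := D.ν_inv_of_eq_zero hsν
    by_cases hrq : r ∣ q - 1
    · have hqr' : ¬ q ∣ r - 1 := fun h => by
        have h1 := Nat.le_of_dvd (by have := hr.two_le; omega) h
        have h2 := Nat.le_of_dvd (by have := hq.two_le; omega) hrq
        have := hr.two_le
        omega
      refine D.exists_tour_of_central hq hcard ht (A := [s, s⁻¹]) ?_ rfl htq htχ htν ?_ (by simp)
        ?_ fun g => ?_
      · simpa using ⟨hs, hS s hs⟩
      · have htk := D.ν_pow_of_χ_eq_one htχ (r - 1)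
        have h1 : (interleave t (r - 1) [s, s⁻¹]).prod =
            t ^ (r - 1) * (s * (t ^ (r - 1) * s⁻¹)) := by simp [interleave]
        rw [h1]
        simp only [ν_mul, map_pow, htχ, hsχ, hsν, hsνinv, htk]
        ring
      · rw [hq.dvd_mul, not_or]
        exact ⟨hqr', fun h => hq2 ((Nat.prime_dvd_prime_iff_eq hq Nat.prime_two).1 h)⟩
      · obtain ⟨j, hj, g', hg', h⟩ :=
          exists_coset_of_prime_index _ hsz Nat.prime_two hz (D.α g)
        refine ⟨s ^ j, ?_, by rw [h, map_pow, inv_mul_cancel_left]; exact hg'⟩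
        interval_cases j <;> simp [visits]
    · obtain ⟨k, hk⟩ : ∃ k, q = k + 2 := ⟨q - 2, by have := hq.two_le; omega⟩
      have hM : ∀ z ∈ t :: (List.replicate k t ++ [t]), z ∈ S := by
        intro z hz
        simp only [List.mem_cons, List.mem_append, List.mem_replicate, List.not_mem_nil,
          or_false] at hz
        rcases hz with rfl | ⟨_, rfl⟩ | rfl <;> exact ht
      have htour := (isTour_extend Nat.prime_two
        ((Nat.coprime_primes Nat.prime_two hq).2 hq2.symm) hcard hsz htq
        (htq.trans hk)).2 0 rfl
      refine D.exists_tour_of_isUnit (L := extendEven t (List.replicate k t) s 0)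
        (mem_extendEven hS hM hs) (by simpa [map_extendEven] using htour)
        (isUnit_iff_ne_zero.2 fun h0 => ?_)
      have htk := D.ν_pow_of_χ_eq_one htχ k
      simp only [extendEven_prod, List.prod_replicate, pow_zero, one_mul, mul_zero, zero_add,
        pow_one, ν_mul, ν_inv, χ_inv, map_pow, hsν, htk, htχ, hsχ, one_pow, inv_one] at h0
      -- The `q - 1` letters `t` and the `q - 1` letters `t⁻¹` contribute equally, since `s` in
      -- between inverts the kernel.
      have h1 : (2 : ZMod r) * ((q : ZMod r) - 1) * D.ν t = 0 := by
        rw [hk]; push_cast; linear_combination h0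
      have h2 : (2 : ZMod r) ≠ 0 := fun h => hone (by linear_combination -h)
      exact mul_ne_zero (mul_ne_zero h2 (natCast_sub_one_ne_zero hq.one_lt.le hrq)) htν h1
  · rw [hio.neg_one_pow] at htχ
    have hzα : orderOf (D.α (s * t)) = q := by
      rw [map_mul, hti, ← pow_succ']
      exact hord hio.add_one (by rwa [pow_succ', ← hti])
    have hzχ : D.χ (s * t) = 1 := by rw [map_mul, hsχ, htχ]; ring
    have hzν : D.ν (s * t) ≠ 0 := by
      rw [ν_mul, hsν, hsχ]; simpa using htν
    have hz := D.orderOf_eq_mul hqr hzα hzχ hzν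
    have hcardG : Nat.card G = 2 * Nat.card (Subgroup.zpowers (s * t)) := by
      rw [Nat.card_zpowers, hz, D.card_eq, hcard, mul_assoc]
    have hindex : (Subgroup.zpowers (s * t)).index = 2 := by
      have := (Subgroup.zpowers (s * t)).card_mul_index
      rw [hcardG, mul_comm] at this
      exact Nat.eq_of_mul_eq_mul_right Nat.card_pos this
    have hsz : s ∉ Subgroup.zpowers (s * t) := by
      intro h
      obtain ⟨j, -, hj⟩ := exists_pow_of_mem_zpowers (orderOf_pos (s * t)) h
      exact hsχ1 (by rw [hj, map_pow, hzχ, one_pow])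
    have hprod : [s, t].prod = s * t := by simp
    refine ⟨_, fun z hz => ?_, IsTour.of_powers (L := [s, t]) ?_ fun g _ => ?_⟩
    · simp only [List.mem_flatten, List.mem_replicate] at hz
      obtain ⟨l, ⟨_, rfl⟩, h⟩ := hz
      simp only [List.mem_cons, List.not_mem_nil, or_false] at h
      rcases h with rfl | rfl
      exacts [hs, ht]
    · rw [hprod, Subgroup.card_top, hcardG, Nat.card_zpowers]; rfl
    · rw [hprod]
      by_cases hg : g ∈ Subgroup.zpowers (s * t)
      · obtain ⟨j, -, hj⟩ := exists_pow_of_mem_zpowers (orderOf_pos (s * t)) hg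
        exact ⟨j, 1, by simp [visits], by simpa using hj⟩
      · have : g * s⁻¹ ∈ Subgroup.zpowers (s * t) := by
          rw [Subgroup.mul_mem_iff_of_index_two hindex]
          simp [hg, hsz]
        obtain ⟨j, -, hj⟩ := exists_pow_of_mem_zpowers (orderOf_pos (s * t)) this
        exact ⟨j, s, by simp [visits], by rw [← hj]; simp⟩

/-- Two noncommuting generators, one of which generates modulo the kernel. -/
lemma exists_tour_of_generator [Finite G] {p q : ℕ} (hp : p.Prime) (hq : q.Prime)
    (hpq : p.Coprime q) (hpr : p.Coprime r) (hqr : q.Coprime r) (hcard : Nat.card Q = p * q)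
    {S : Set G} (hS : ∀ z ∈ S, z⁻¹ ∈ S) {s t : G} (hs : s ∈ S) (ht : t ∈ S)
    (hsα : orderOf (D.α s) = Nat.card Q) (ht1 : D.α t ≠ 1) (hst : D.α s * D.α t ≠ 1)
    (hcomm : ¬ Commute s t) :
    ∃ L, (∀ z ∈ L, z ∈ S) ∧ IsTour (⊤ : Subgroup G) L := by
  have : Finite Q := Finite.of_surjective _ D.surjective
  have hsχ := D.isUnit_χ_sub_one hsα
  obtain ⟨w, hw⟩ := D.exists_gauge hsχ
  have hsχ1 : D.χ s ≠ 1 := sub_ne_zero.1 hsχ.ne_zero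
  let E := D.gauge w
  have htν : E.ν t ≠ 0 := fun h => hcomm (E.commute_of_ν_eq_zero hw h)
  by_cases hb : D.χ s = -1
  · have h2 : 2 ∣ p * q := by
      have h1 := D.χ_pow_eq_one hsα
      rw [hb] at h1
      rw [← hcard, ← even_iff_two_dvd]
      by_contra hodd
      rw [(Nat.not_even_iff_odd.1 hodd).neg_one_pow] at h1
      exact hsχ1 (hb.trans h1)
    rcases Nat.prime_two.dvd_mul.1 h2 with h2 | h2
    · obtain rfl := (Nat.prime_dvd_prime_iff_eq Nat.prime_two hp).1 h2
      exact E.exists_tour_of_χ_eq_neg_one hq (by rintro rfl; norm_num at hpq) hqr hcard hS hs ht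
        hsα ht1 hst hb hsχ1 hw htν
    · obtain rfl := (Nat.prime_dvd_prime_iff_eq Nat.prime_two hq).1 h2
      exact E.exists_tour_of_χ_eq_neg_one hp (by rintro rfl; norm_num at hpq) hpr
        (hcard.trans (mul_comm p 2)) hS hs ht hsα ht1 hst hb hsχ1 hw htν
  · obtain ⟨i, hi, hti⟩ := exists_pow_of_mem_zpowers (orderOf_pos (D.α s))
      (mem_zpowers_of_orderOf_eq hsα (D.α t))
    have hi0 : i ≠ 0 := by rintro rfl; exact ht1 (by simpa using hti)
    obtain ⟨k, rfl⟩ : ∃ k, i = k + 1 := ⟨i - 1, by omega⟩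
    obtain ⟨l, hl⟩ : ∃ l, orderOf (D.α s) = k + l + 2 := ⟨orderOf (D.α s) - (k + 2), by omega⟩
    obtain ⟨L, hLS, hL, hLν⟩ := E.exists_two_chords hS hs ht hti hl hw
    have htop : Subgroup.zpowers (E.α s) = ⊤ :=
      eq_top_iff.2 fun y _ => mem_zpowers_of_orderOf_eq hsα y
    refine E.exists_tour_of_isUnit hLS (htop ▸ hL) (isUnit_iff_ne_zero.2 ?_)
    rw [hLν]
    exact mul_ne_zero (fun h => hb (show E.χ s = -1 by linear_combination h)) htν

/-- Two noncommuting generators of the same prime order `p` modulo the kernel and a third one that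
commutes with both. -/
lemma exists_tour_of_commute [Finite G] {p q : ℕ} (hp : p.Prime) (hq : q.Prime)
    (hcard : Nat.card Q = p * q) {S : Set G} (hS : ∀ z ∈ S, z⁻¹ ∈ S) {s t u : G}
    (hs : s ∈ S) (ht : t ∈ S) (hu : u ∈ S) (hsα : orderOf (D.α s) = p)
    (htα : orderOf (D.α t) = p) (hts : D.α t ∈ Subgroup.zpowers (D.α s))
    (hne : D.α t ≠ D.α s) (hcomm : ¬ Commute s t) (hus : Commute u s) (hut : Commute u t)
    (huα : D.α u ∉ Subgroup.zpowers (D.α s)) :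
    ∃ L, (∀ z ∈ L, z ∈ S) ∧ IsTour (⊤ : Subgroup G) L := by
  have : Finite Q := Finite.of_surjective _ D.surjective
  have hr : r.Prime := Fact.out
  obtain ⟨i, hi, hti⟩ := exists_pow_of_mem_zpowers (by rw [hsα]; exact hp.pos) hts
  have hsχ1 : D.χ s ≠ 1 := by
    intro h
    have htχ : D.χ t = 1 := by
      rw [D.χ_congr (h := s ^ i) (by simpa using hti), map_pow, h, one_pow]
    exact hcomm (D.ext (by simp [mul_comm]) (by rw [ν_mul, ν_mul, h, htχ]; ring))
  obtain ⟨w, hw⟩ := D.exists_gauge (isUnit_iff_ne_zero.2 (sub_ne_zero.2 hsχ1))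
  let E := D.gauge w
  have htν : E.ν t ≠ 0 := fun h => hcomm (E.commute_of_ν_eq_zero hw h)
  have hi0 : i ≠ 0 := by
    rintro rfl
    rw [hti] at htα
    simp only [pow_zero, orderOf_one] at htα
    exact hp.one_lt.ne htα
  obtain ⟨k, rfl⟩ : ∃ k, i = k + 1 := ⟨i - 1, by omega⟩
  obtain ⟨l, hl⟩ : ∃ l, orderOf (D.α s) = k + l + 2 := ⟨orderOf (D.α s) - (k + 2), by omega⟩
  -- For odd `p` this contradicts `χ s ^ p = 1`; for `p = 2` the only nontrivial power of `α s` is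
  -- `α s` itself, which `α t` is not.
  have hb : D.χ s ≠ -1 := by
    intro hb
    have h1 := D.χ_pow_eq_one hsα
    rcases hp.eq_two_or_odd' with rfl | hodd
    · have : k + 1 = 1 := by omega
      rw [this, pow_one] at hti
      exact hne hti
    · rw [hb, hodd.neg_one_pow] at h1
      exact hsχ1 (hb.trans h1)
  let T : Set G := {s, s⁻¹, t, t⁻¹}
  have hTS : T ⊆ S := by
    rintro z (rfl | rfl | rfl | rfl)
    exacts [hs, hS _ hs, ht, hS _ ht]
  obtain ⟨L, hLS, hL, hLν⟩ := E.exists_two_chords (S := T)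
    (by rintro z (rfl | rfl | rfl | rfl) <;> simp [T]) (s := s) (t := t) (by simp [T]) (by simp [T])
    hti hl hw
  obtain ⟨W, hWT, hW⟩ := E.exists_tour_comap hLS hL (isUnit_iff_ne_zero.2 (by
    rw [hLν]
    exact mul_ne_zero (fun h => hb (show E.χ s = -1 by linear_combination h)) htν))
  -- The tour of `H` uses only `s`, `t` and their inverses, all commuting with `u`, so it extends
  -- through the `q` cosets `u ^ i * H`.
  set H := (Subgroup.zpowers (E.α s)).comap E.α
  have hH : Nat.card H = p * r := by
    rw [card_comap_of_surjective _ E.surjective, E.card_ker, Nat.card_zpowers]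
    exact congrArg (· * r) hsα
  have hcardG : Nat.card G = q * Nat.card H := by rw [hH, D.card_eq, hcard]; ring
  obtain ⟨x, W, rfl⟩ : ∃ x W', W = x :: W' := by
    cases W with
    | nil =>
      have := hW.length_eq
      rw [hH] at this
      have := mul_pos hp.pos hr.pos
      simp at *; omega
    | cons x W => exact ⟨x, W, rfl⟩
  have hHT : HasTour T H x := hasTour_of_isTour hW hWT
    (by rw [hH]; nlinarith [hp.two_le, hr.two_le])
  have hc : ∀ z ∈ T, Commute u z := by
    rintro z (rfl | rfl | rfl | rfl)
    exacts [hus, hus.inv_right, hut, hut.inv_right]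
  obtain ⟨M, y, hM, hMt⟩ := hHT.extend hS hTS hu hc hq.one_lt.le (K := ⊤)
    (by rw [Subgroup.card_top, hcardG])
    fun g _ => exists_coset_of_prime_index H (u := u) huα hq hcardG g
  exact ⟨_, hM, hMt⟩

end AffineCoord

namespace AffineCoord

variable {G Q : Type*} [Group G] [CommGroup Q] {r : ℕ} [Fact r.Prime]

/-- Otherwise `G` is abelian, while some `a` acts on the kernel without nontrivial fixed points. -/
lemma exists_not_commute [Finite G] (D : AffineCoord G Q r) {S : Set G}
    (hgen : Subgroup.closure S = ⊤) :
    ∃ s ∈ S, ∃ t ∈ S, ¬ Commute s t := by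
  by_contra! h
  have hcomm (a b : G) : Commute a b := by
    have : IsMulCommutative (Subgroup.closure S) := Subgroup.isMulCommutative_closure h
    have ha : a ∈ Subgroup.closure S := hgen ▸ Subgroup.mem_top a
    have hb : b ∈ Subgroup.closure S := hgen ▸ Subgroup.mem_top b
    exact congrArg Subtype.val (mul_comm' (⟨a, ha⟩ : Subgroup.closure S) ⟨b, hb⟩)
  obtain ⟨a, ha⟩ := D.exists_isUnit
  obtain ⟨x, hx, hx1⟩ := D.exists_eq 1 1
  have h1 := congrArg D.ν (hcomm a x).eq
  rw [ν_mul, ν_mul, hx1, D.χ_eq_one x hx] at h1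
  exact ha.ne_zero (by linear_combination h1)

/-- Modulo the powers of `x`, a group of order `q` remains, in which the class of `y` is killed by
the coprime numbers `p` and `q`. -/
lemma _root_.mem_zpowers_of_pow_eq_one [Finite Q] {p q : ℕ} (hp : 0 < p) (hpq : p.Coprime q)
    (hcard : Nat.card Q = p * q) {x y : Q} (hx : orderOf x = p) (hy : y ^ p = 1) :
    y ∈ Subgroup.zpowers x := by
  rw [← QuotientGroup.eq_one_iff]
  refine eq_one_of_pow hpq (by rw [← QuotientGroup.mk_pow, hy, QuotientGroup.mk_one]) ?_
  have hindex : (Subgroup.zpowers x).index = q := by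
    have := (Subgroup.zpowers x).card_mul_index
    rw [Nat.card_zpowers, hx, hcard] at this
    exact Nat.eq_of_mul_eq_mul_left hp this
  rw [← QuotientGroup.mk_pow, QuotientGroup.eq_one_iff, ← hindex]
  exact Subgroup.pow_index_mem _ y

/-- Two noncommuting generators have the same prime order modulo the kernel. -/
lemma exists_tour_of_orderOf_eq [Finite G] (D : AffineCoord G Q r) {p q : ℕ} (hp : p.Prime)
    (hq : q.Prime) (hpq : p.Coprime q) (hpr : p.Coprime r) (hqr : q.Coprime r)
    (hcard : Nat.card Q = p * q) {S : Set G} (hS : ∀ z ∈ S, z⁻¹ ∈ S) (hgen : Subgroup.closure S = ⊤)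
    (hS1 : ∀ z ∈ S, D.α z ≠ 1) (hinj : Set.InjOn D.α S) {s t : G} (hs : s ∈ S) (ht : t ∈ S)
    (hcomm : ¬ Commute s t) (hsα : orderOf (D.α s) = p) (htα : orderOf (D.α t) = p) :
    ∃ L, (∀ z ∈ L, z ∈ S) ∧ IsTour (⊤ : Subgroup G) L := by
  have : Finite Q := Finite.of_surjective _ D.surjective
  have hts : D.α t ∈ Subgroup.zpowers (D.α s) :=
    mem_zpowers_of_pow_eq_one hp.pos hpq hcard hsα (htα ▸ pow_orderOf_eq_one _)
  have hne : D.α t ≠ D.α s := fun h => hcomm (hinj ht hs h ▸ Commute.refl _)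
  obtain ⟨u, hu, huα⟩ : ∃ u ∈ S, D.α u ∉ Subgroup.zpowers (D.α s) := by
    by_contra! h
    have htop : (Subgroup.zpowers (D.α s)).comap D.α = ⊤ :=
      top_le_iff.1 (hgen ▸ (Subgroup.closure_le _).2 h)
    have hQ : Subgroup.zpowers (D.α s) = ⊤ := by
      refine eq_top_iff.2 fun y _ => ?_
      obtain ⟨g, rfl⟩ := D.surjective y
      exact (htop ▸ Subgroup.mem_top g : g ∈ (Subgroup.zpowers (D.α s)).comap D.α)
    have h1 := congrArg (fun H : Subgroup Q => Nat.card H) hQ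
    simp only [Nat.card_zpowers, Subgroup.card_top, hsα, hcard] at h1
    nlinarith [hp.pos, hq.two_le]
  -- Lying outside the powers of `α s`, `α u` has order `q` or `p * q`; a `v` not commuting with `u`
  -- then leads back to an earlier case.
  have key {v : G} (hv : v ∈ S) (hvα : orderOf (D.α v) = p) (huv : ¬ Commute u v) :
      ∃ L, (∀ z ∈ L, z ∈ S) ∧ IsTour (⊤ : Subgroup G) L := by
    have hd : orderOf (D.α u) ∣ p * q := hcard ▸ orderOf_dvd_natCard _
    have hup : orderOf (D.α u) ≠ p := fun h => huα
      (mem_zpowers_of_pow_eq_one hp.pos hpq hcard hsα (h ▸ pow_orderOf_eq_one _))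
    rcases (Nat.dvd_mul.1 hd) with ⟨a, b, ha, hb, hab⟩
    rcases (Nat.dvd_prime hp).1 ha with rfl | rfl <;>
      rcases (Nat.dvd_prime hq).1 hb with rfl | rfl
    · exact absurd (orderOf_eq_one_iff.1 (by rw [← hab])) (hS1 u hu)
    · exact D.exists_tour_of_coprime_orders hp hq hpq hcard hS hv hu hvα (by rw [← hab, one_mul])
        fun h => huv h.symm
    · exact absurd (by rw [← hab, mul_one]) hup
    · refine D.exists_tour_of_generator hp hq hpq hpr hqr hcard hS hu hv
        (by rw [← hab, hcard]) (hS1 v hv) (fun h => huv ?_) huv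
      have : u⁻¹ = v := hinj (hS u hu) hv (by rw [map_inv, inv_eq_iff_mul_eq_one, h])
      exact this ▸ (Commute.refl u).inv_right
  by_cases hus : Commute u s
  · by_cases hut : Commute u t
    · exact D.exists_tour_of_commute hp hq hcard hS hs ht hu hsα htα hts hne hcomm hus hut huα
    · exact key ht htα hut
  · exact key hs hsα hus

theorem exists_tour_of_prime_kernel [Finite G] (D : AffineCoord G Q r) {p q : ℕ} (hp : p.Prime)
    (hq : q.Prime) (hpq : p.Coprime q) (hpr : p.Coprime r) (hqr : q.Coprime r)
    (hcard : Nat.card Q = p * q) {S : Set G} (hS : ∀ z ∈ S, z⁻¹ ∈ S) (hgen : Subgroup.closure S = ⊤)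
    (hS1 : 1 ∉ S) : ∃ L, (∀ z ∈ L, z ∈ S) ∧ IsTour (⊤ : Subgroup G) L := by
  have : Finite Q := Finite.of_surjective _ D.surjective
  have : Nontrivial Q := Finite.one_lt_card_iff_nontrivial.1
    (by rw [hcard]; exact Nat.one_lt_mul_iff.2 ⟨hp.pos, hq.pos, .inl hp.one_lt⟩)
  by_cases hker : ∃ t ∈ S, D.α t = 1
  · obtain ⟨t, ht, ht1⟩ := hker
    exact D.exists_tour_of_mem_ker hS hgen ht ht1 fun h => hS1 (h ▸ ht)
  push Not at hker
  by_cases hinj : Set.InjOn D.α S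
  swap
  · simp only [Set.InjOn, not_forall] at hinj
    obtain ⟨s, hs, t, ht, hst, hne⟩ := hinj
    exact D.exists_tour_of_α_eq hS hgen hs ht (hker s hs) hst hne
  obtain ⟨s, hs, t, ht, hcomm⟩ := D.exists_not_commute hgen
  -- Injectivity of `α` on generators turns `α s * α t = 1` into `t = s⁻¹`, which commutes with `s`.
  have hst : D.α s * D.α t ≠ 1 := fun h => hcomm (by
    have : s⁻¹ = t := hinj (hS s hs) ht (by rw [map_inv, inv_eq_iff_mul_eq_one, h])
    exact this ▸ (Commute.refl s).inv_right)
  have hord {z : G} (hz : z ∈ S) : orderOf (D.α z) = p ∨ orderOf (D.α z) = q ∨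
      orderOf (D.α z) = Nat.card Q := by
    obtain ⟨a, b, ha, hb, hab⟩ := Nat.dvd_mul.1 (hcard ▸ orderOf_dvd_natCard (D.α z))
    have h1 : orderOf (D.α z) ≠ 1 := fun h => hker z hz (orderOf_eq_one_iff.1 h)
    rcases (Nat.dvd_prime hp).1 ha with rfl | rfl <;>
      rcases (Nat.dvd_prime hq).1 hb with rfl | rfl
    · exact absurd hab.symm h1
    · exact .inr (.inl (by rw [← hab, one_mul]))
    · exact .inl (by rw [← hab, mul_one])
    · exact .inr (.inr (by rw [← hab, hcard]))
  have hcard' : Nat.card Q = q * p := hcard.trans (mul_comm p q)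
  have hcomm' : ¬ Commute t s := fun h => hcomm h.symm
  rcases hord hs with hsα | hsα | hsα <;> rcases hord ht with htα | htα | htα
  · exact D.exists_tour_of_orderOf_eq hp hq hpq hpr hqr hcard hS hgen hker hinj hs ht hcomm hsα htα
  · exact D.exists_tour_of_coprime_orders hp hq hpq hcard hS hs ht hsα htα hcomm
  · exact D.exists_tour_of_generator hp hq hpq hpr hqr hcard hS ht hs htα (hker s hs)
      (by rwa [mul_comm]) hcomm'
  · exact D.exists_tour_of_coprime_orders hp hq hpq hcard hS ht hs htα hsα hcomm'
  · exact D.exists_tour_of_orderOf_eq hq hp hpq.symm hqr hpr hcard' hS hgen hker hinj hs ht hcomm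
      hsα htα
  · exact D.exists_tour_of_generator hp hq hpq hpr hqr hcard hS ht hs htα (hker s hs)
      (by rwa [mul_comm]) hcomm'
  all_goals
    exact D.exists_tour_of_generator hp hq hpq hpr hqr hcard hS hs ht hsα (hker t ht) hst hcomm

end AffineCoord

/-! ### The abelian case and the assembly over the divisors of `pqr` -/

theorem exists_tour_of_bijective {G Q : Type*} [Group G] [CommGroup Q] [Finite G] (f : G →* Q)
    (hf : Function.Bijective f) {S : Set G} (hS : ∀ z ∈ S, z⁻¹ ∈ S)
    (hgen : Subgroup.closure S = ⊤) [Nontrivial G] :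
    ∃ L, (∀ z ∈ L, z ∈ S) ∧ IsTour (⊤ : Subgroup G) L := by
  have : Finite Q := Finite.of_surjective _ hf.2
  obtain ⟨x, hx, hx1⟩ : ∃ x ∈ S, x ≠ 1 := by
    by_contra! h
    rw [(Subgroup.closure_eq_bot_iff).2 h] at hgen
    exact bot_ne_top hgen
  obtain ⟨L, hL, hT⟩ := exists_tour_map f hf.2 hS hgen hx
    (fun h => hx1 (hf.1 (h.trans (map_one f).symm)))
  refine ⟨x :: L, hL, hf.1 (by rw [map_list_prod, hT.prod_eq, map_one]), ?_, fun g _ => ?_⟩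
  · rw [Subgroup.card_top, Nat.card_eq_of_bijective f hf, ← Subgroup.card_top (G := Q),
      ← hT.length_eq, List.length_map]
  · have := hT.mem_visits (f g) (Subgroup.mem_top _)
    rw [← map_one f, visits_map, List.mem_map] at this
    obtain ⟨g', h, hg⟩ := this
    exact hf.1 hg ▸ h

lemma closure_eq_top_of_connected {G : Type*} [Group G] {S : Set G}
    (hS : (SimpleGraph.mulCayley S).Connected) : Subgroup.closure S = ⊤ := by
  refine eq_top_iff.2 fun g _ => ?_
  obtain ⟨w⟩ := hS.preconnected 1 g
  have key {u v : G} (w : (SimpleGraph.mulCayley S).Walk u v) (hu : u ∈ Subgroup.closure S) :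
      v ∈ Subgroup.closure S := by
    induction w with
    | nil => exact hu
    | cons h _ ih =>
      apply ih
      rcases ((SimpleGraph.mulCayley_adj _ _ _).1 h).2 with h | h
      · simpa using mul_mem hu (Subgroup.subset_closure h)
      · simpa using mul_mem hu (inv_mem (Subgroup.subset_closure h))
  exact key w (one_mem _)

theorem exists_tour_of_card_eq_mul {G : Type*} [Group G] [Finite G] {p q r : ℕ} (hp : p.Prime)
    (hq : q.Prime) (hr : r.Prime) (hpq : p ≠ q) (hpr : p ≠ r) (hqr : q ≠ r)
    (hG : Nat.card G = p * q * r) {S : Set G} (hS : ∀ z ∈ S, z⁻¹ ∈ S)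
    (hgen : Subgroup.closure S = ⊤) (hS1 : 1 ∉ S) :
    ∃ L, (∀ z ∈ L, z ∈ S) ∧ IsTour (⊤ : Subgroup G) L := by
  have cpq := (Nat.coprime_primes hp hq).2 hpq
  have cpr := (Nat.coprime_primes hp hr).2 hpr
  have cqr := (Nat.coprime_primes hq hr).2 hqr
  have : IsZGroup G := IsZGroup.of_squarefree (by
    rw [hG, Nat.squarefree_mul (cpr.mul_left cqr), Nat.squarefree_mul cpq]
    exact ⟨⟨hp.squarefree, hq.squarefree⟩, hr.squarefree⟩)
  have : Nontrivial G := Finite.one_lt_card_iff_nontrivial.1 (by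
    rw [hG]; exact Nat.one_lt_mul_iff.2 ⟨mul_pos hp.pos hq.pos, hr.pos, .inr hr.one_lt⟩)
  obtain ⟨D⟩ := IsZGroup.nonempty_affineCoord G
  -- Making `n` a variable allows substituting each candidate value into the type of `D`.
  generalize hn : Nat.card (commutator G) = n at D
  have hcard : Nat.card (Abelianization G) * n = p * q * r := D.card_eq ▸ hG
  obtain ⟨ab, c, hab, hc, habc⟩ := Nat.dvd_mul.1 (hcard ▸ dvd_mul_left n _ : n ∣ p * q * r)
  obtain ⟨a, b, ha, hb, rfl⟩ := Nat.dvd_mul.1 hab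
  have hn0 : 0 < n := hn ▸ Nat.card_pos
  have hQ {m k : ℕ} (hk : n = k) (h : m * k = p * q * r) : Nat.card (Abelianization G) = m :=
    Nat.eq_of_mul_eq_mul_right hn0 (by rw [hcard, hk, h])
  have kernel {p' q' r' : ℕ} (hp' : p'.Prime) (hq' : q'.Prime) (hr' : r'.Prime)
      (hpq' : p'.Coprime q') (hpr' : p'.Coprime r') (hqr' : q'.Coprime r') (hr'n : n = r')
      (h : p' * q' * r' = p * q * r) : ∃ L, (∀ z ∈ L, z ∈ S) ∧ IsTour (⊤ : Subgroup G) L := by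
    have hQ' := hQ hr'n h
    subst hr'n
    have := Fact.mk hr'
    exact D.exists_tour_of_prime_kernel hp' hq' hpq' hpr' hqr' hQ' hS hgen hS1
  rcases (Nat.dvd_prime hp).1 ha with ha | ha <;> rcases (Nat.dvd_prime hq).1 hb with hb | hb <;>
    rcases (Nat.dvd_prime hr).1 hc with hc | hc <;>
    simp only [ha, hb, hc, one_mul, mul_one] at habc
  · subst habc
    refine exists_tour_of_bijective D.α ⟨(injective_iff_map_eq_one _).2 fun g hg => ?_,
      D.surjective⟩ hS hgen
    exact D.eq_one g hg (Subsingleton.elim (α := ZMod 1) _ _)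
  · exact kernel hp hq hr cpq cpr cqr habc.symm rfl
  · exact kernel hp hr hq cpr cpq cqr.symm habc.symm (by ring)
  · exact D.exists_tour_of_prime_card habc.symm (hQ (m := p) habc.symm (by ring) ▸ hp) hq hr hS hgen
  · exact kernel hq hr hp cqr cpq.symm cpr.symm habc.symm (by ring)
  · exact D.exists_tour_of_prime_card habc.symm (hQ (m := q) habc.symm (by ring) ▸ hq) hp hr hS hgen
  · exact D.exists_tour_of_prime_card habc.symm (hQ (m := r) habc.symm (by ring) ▸ hr) hp hq hS hgen
  -- With trivial abelianization `χ` would be `1`, and `χ a - 1 = 0` is no unit.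
  · have : Subsingleton (Abelianization G) :=
      (Nat.card_eq_one_iff_unique.1 (hQ habc.symm (one_mul _))).1
    have : Fact (1 < n) := ⟨by rw [← habc, ← hG]; exact Finite.one_lt_card⟩
    obtain ⟨a, ha⟩ := D.exists_isUnit
    rw [D.χ_eq_one a (Subsingleton.elim _ _), sub_self] at ha
    exact absurd ha not_isUnit_zero

theorem proposition6p2 {G : Type*} [Group G] [Fintype G] [DecidableEq G]
    (p q r : ℕ) (hp : p.Prime) (hq : q.Prime) (hr : r.Prime)
    (hpq : p ≠ q) (hpr : p ≠ r) (hqr : q ≠ r)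
    (hG : Fintype.card G = p * q * r)
    (S : Set G) (hS : (SimpleGraph.mulCayley S).Connected) :
    ∃ (g : G) (c : (SimpleGraph.mulCayley S).Walk g g), c.IsHamiltonianCycle := by
  -- The connection set is made symmetric and freed of the identity; this changes neither the graph
  -- nor the generated subgroup.
  have hgen : Subgroup.closure {z : G | z ≠ 1 ∧ (z ∈ S ∨ z⁻¹ ∈ S)} = ⊤ := by
    rw [eq_top_iff, ← closure_eq_top_of_connected hS, Subgroup.closure_le]
    intro z hz
    by_cases h : z = 1
    · subst h; exact one_mem _
    · exact Subgroup.subset_closure ⟨h, .inl hz⟩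
  obtain ⟨L, hL, hT⟩ := exists_tour_of_card_eq_mul hp hq hr hpq hpr hqr
    (Nat.card_eq_fintype_card.trans hG)
    (S := {z : G | z ≠ 1 ∧ (z ∈ S ∨ z⁻¹ ∈ S)})
    (fun z hz => ⟨inv_ne_one.2 hz.1, by rw [inv_inv]; exact hz.2.symm⟩) hgen
    fun h => h.1 rfl
  refine exists_isHamiltonianCycle hL hT ?_
  rw [hG]
  nlinarith [hp.two_le, hq.two_le, hr.two_le, Nat.mul_le_mul hp.two_le hq.two_le]
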